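/- Throughout, for a finite graph $H$ and a vertex set $T$, $e(T)$ is the number of edges of $H$ with both ends in $T$, and $G_{n,q}$ is the binomial random graph on $[n]$. An embedding of a graph into another is an injective map of the vertices that sends edges to edges. Let $H$ be a finite graph with maximum degree at most $\Delta$, and let $\alpha>0$, $n\in\mathbb N$. An $\alpha$-good partition $(H',\mathcal S_1,\dots,\mathcal S_k)$ of $H$ (with respect to $n$) consists of families (batches) $\mathcal S_i$ of induced subgraphs of $H$, with $H'=H\setminus\bigcup_i\bigcup_{S\in\mathcal S_i}S$, such that (i) for every $i$ and all $S,S'\in\mathcal S_i$ there is a graph isomorphism $\varphi:S\to S'$ with $\deg_H(v)=\deg_H(\varphi(v))$ for all $v\in V(S)$; (ii) $|\mathcal S_i|\le \alpha n$ for every $i$; (iii) every $S\in\bigcup_i\mathcal S_i$ has $|V(S)|\ge 3$ and $$\frac{e(T)}{|T|-2}\le\frac{\Delta+1}{2}<\frac{e(S)}{|V(S)|-2}\qquad\text{for every } T\subsetneq V(S)\text{ with }|T|\ge 3;$$ (iv) the batches are pairwise disjoint, and any two distinct graphs in $\bigcup_i \mathcal S_i$ are vertex-disjoint; (v) for every $i$,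 any two distinct $S,S'\in\mathcal S_i$ are at distance at least $3$ in $H$; (vi) $e(T)/(|T|-2)\le(\Delta+1)/2$ for every $T\subseteq V(H')$ with $|T|\ge3$. For $0\le h\le k$ let $H_h$ be the subgraph of $H$ induced on the vertices of $H'$ and of all $S\in\mathcal S_i$ with $i\le h$. **Lemma.** Let $\varepsilon>0$, let $\Delta\ge5$ be an integer, put $\alpha=\varepsilon/(3(2\Delta+1)^2)$, let $K\in\mathbb N$ and let $p=p(n)$ satisfy $p=\omega\big((n^{-1}\log^{1/\Delta}n)^{2/(\Delta+1)}\big)$. For every $\delta>0$ there is an $N_0$ such that the following holds for all $n\ge N_0$. Let $H$ be a graph with at most $(1-\varepsilon)n$ vertices and maximum degree at most $\Delta$, let $(H',\mathcal S_1,\dots,\mathcal S_k)$ be an $\alpha$-good partition of $H$ with $k\le K$, let $q\in(0,1)$ satisfy $(1-q)^{k+1}=1-p(n)$, and let $G_0,\dots,G_k$ be independent copies of $G_{n,q}$. Let $0\le h\le k-1$. Then for all graphs $g_0,\dots,g_h$ on $[n]$ and every embedding $f$ of $H_h$ into $\bigcup_{i\le h}g_i$, conditionally on $G_i=g_i$ for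 all $i\le h$, with probability at least $1-\delta$ the embedding $f$ extends to an embedding of $H_{h+1}$ into $\bigcup_{i\le h+1}G_i$ that maps every edge of $H_{h+1}$ not contained in $H_h$ to an edge of $G_{h+1}$. -/

import Mathlib

open MeasureTheory ProbabilityTheory Filter Asymptotics
open scoped SimpleGraph

namespace AlmostSpanning

section Partition

variable {V : Type*} (H : SimpleGraph V)

/-- `e(T)`: the number of edges of the subgraph of `H` induced on the vertex set `T`. -/
noncomputable def numEdges (T : Finset V) : ℕ :=
  (H.induce (T : Set V)).edgeSet.ncard

/-- The ratio `e(T) / (v(T) - 2)` of the subgraph of `H` induced on `T` (used for `v(T) ≥ 3`). -/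
noncomputable def density (T : Finset V) : ℝ :=
  (numEdges H T : ℝ) / ((T.card : ℝ) - 2)

/-- Two induced subgraphs of `H` (given by their vertex sets) are isomorphic in `H`: there is an
isomorphism between them that preserves the degrees of the vertices in the whole graph `H`. -/
def IsoIn [Fintype V] [DecidableRel H.Adj] (S S' : Finset V) : Prop :=
  ∃ φ : H.induce (S : Set V) ≃g H.induce (S' : Set V),
    ∀ v : (S : Set V), H.degree (v : V) = H.degree (φ v : V)

variable {k : ℕ} (𝒮 : Fin k → Finset (Finset V))

/-- The vertex set of `H' = H \ ⋃ᵢ ⋃_{S ∈ 𝒮ᵢ} S`. -/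
def sparseVerts : Set V :=
  {v | ∀ i, ∀ S ∈ 𝒮 i, v ∉ S}

/-- The vertex set of `H_h`, that is, of `H'` together with the first `h` batches
(batch number `i + 1` is `𝒮 i`, for `i = 0, …, k - 1`). -/
def stageVerts (h : ℕ) : Set V :=
  sparseVerts 𝒮 ∪ {v | ∃ i : Fin k, (i : ℕ) < h ∧ ∃ S ∈ 𝒮 i, v ∈ S}

/-- The graph `H_h`: the subgraph of `H` induced on the vertices of `H'` and of the first `h`
batches. -/
abbrev stage (h : ℕ) : SimpleGraph (stageVerts 𝒮 h) :=
  H.induce (stageVerts 𝒮 h)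

/-- `(H', 𝒮₁, …, 𝒮ₖ)` is an `α`-good partition of the graph `H` of maximum degree at most `Δ`,
with respect to the ambient size `n`. Members of the batches are induced subgraphs of `H`, given by
their vertex sets. -/
structure IsGoodPartition [Fintype V] [DecidableRel H.Adj] (Δ n : ℕ) (α : ℝ) : Prop where
  isoIn : ∀ i, ∀ S ∈ 𝒮 i, ∀ S' ∈ 𝒮 i, IsoIn H S S'
  card_le : ∀ i, ((𝒮 i).card : ℝ) ≤ α * n
  three_le : ∀ i, ∀ S ∈ 𝒮 i, 3 ≤ S.card
  dense : ∀ i, ∀ S ∈ 𝒮 i, ((Δ : ℝ) + 1) / 2 < density H S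
  minimal : ∀ i, ∀ S ∈ 𝒮 i, ∀ T : Finset V, T ⊂ S → 3 ≤ T.card →
    density H T ≤ ((Δ : ℝ) + 1) / 2
  disjoint : ∀ i j, ∀ S ∈ 𝒮 i, ∀ S' ∈ 𝒮 j, (i ≠ j ∨ S ≠ S') → Disjoint S S'
  far : ∀ i, ∀ S ∈ 𝒮 i, ∀ S' ∈ 𝒮 i, S ≠ S' → ∀ u ∈ S, ∀ v ∈ S', 3 ≤ H.edist u v
  sparse : ∀ T : Finset V, (T : Set V) ⊆ sparseVerts 𝒮 → 3 ≤ T.card →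
    density H T ≤ ((Δ : ℝ) + 1) / 2

end Partition

section Rounds

/-- The joint law of `k + 1` independent copies `G₀, …, Gₖ` of the binomial random graph
`G_{n,q}`. -/
noncomputable def roundsLaw (n k : ℕ) (q : unitInterval) :
    Measure (Fin (k + 1) → SimpleGraph (Fin n)) :=
  Measure.pi fun _ => SimpleGraph.binomialRandom (Fin n) q

variable {n k : ℕ}

/-- The union `⋃_{i ≤ h} Gᵢ`. -/
def unionUpTo (G : Fin (k + 1) → SimpleGraph (Fin n)) (h : Fin (k + 1)) : SimpleGraph (Fin n) :=
  ⨆ i, ⨆ (_ : i ≤ h), G i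

variable {V : Type*} (H : SimpleGraph V) (𝒮 : Fin k → Finset (Finset V))

/-- The map `f : V(H_h) → [n]` extends to an embedding `f'` of `H_{h+1}` into `⋃_{i ≤ h+1} Gᵢ` such
that every edge of `H_{h+1}` that is not an edge of `H_h` is mapped to an edge of `G_{h+1}`.
(Embeddings are injective graph homomorphisms.) -/
def Extends (h : Fin k) (f : stageVerts 𝒮 (h : ℕ) → Fin n)
    (G : Fin (k + 1) → SimpleGraph (Fin n)) : Prop :=
  ∃ f' : SimpleGraph.Copy (stage H 𝒮 ((h : ℕ) + 1)) (unionUpTo G h.succ),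
    (∀ (v : V) (hv : v ∈ stageVerts 𝒮 (h : ℕ)) (hv' : v ∈ stageVerts 𝒮 ((h : ℕ) + 1)),
      f' ⟨v, hv'⟩ = f ⟨v, hv⟩) ∧
    ∀ u v : stageVerts 𝒮 ((h : ℕ) + 1), H.Adj u v →
      ¬((u : V) ∈ stageVerts 𝒮 (h : ℕ) ∧ (v : V) ∈ stageVerts 𝒮 (h : ℕ)) →
        (G h.succ).Adj (f' u) (f' v)

end Rounds

end AlmostSpanning

/-!
The new batch `𝓢 = 𝒮 h` is embedded by finding, in the fresh random graph `G_{h+1}` and among the at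
least `ε n` vertices not used by `f`, pairwise disjoint copies of all `S ∈ 𝓢` that are joined to the
image of `f` as prescribed by `H` (`IsRelCopy`). Members of a batch are pairwise non-adjacent and the
edges inside `H_h` are already embedded, so such copies extend `f` (`extends_of_hallCondition`).

Disjoint copies exist by Haxell's theorem (`exists_isPartialRep`), as soon as for every nonempty
`I ⊆ 𝓢` and every set `X` of at most `2 s (|I| - 1)` vertices, where `s` is the common size of the
members, some `S ∈ I` has a copy avoiding `X` (`HallCondition`). The choice of `α` guarantees that
linearly many unused vertices remain outside `X`. For a given pair `(I, X)` with `|I| = r`,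
Janson's inequality (`bernExp_avoid_le_exp_weighted`) shows that the condition fails with probability
at most `exp (-κ r / 2)`, where `κ` is a large multiple of `log n`
(`binomialRandom_no_relCopy_le`); this beats the number `n ^ O(r)` of pairs
(`binomialRandom_not_hallCondition_le`).

Janson's inequality needs two second moment conditions. Copies of the same `S` that agree on a
nonempty set `T` share at most the edges that meet `T` and lie in `T ∪ V(H_h)`, and copies of
different members share only edges inside `T`, because members of a batch have no common
neighbours. The minimal density of `S` and the maximum degree bound the numbers of such edges
(`IsMinimalDense.card_relEdges`, `IsMinimalDense.card_innerEdges`), and these bounds match the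
threshold for `p` (`eventually_le_pow_mul_pow`): the tight cases are `|S| = Δ` and `|S| = Δ + 1`,
which is where `Δ ≥ 5` and the logarithmic factor enter.

As the rounds are independent, conditioning on the first ones does not affect `G_{h+1}`
(`cond_roundsLaw_real`).
-/

namespace AlmostSpanning

/-! ### Janson's inequality for product Bernoulli weights -/

section Janson

variable {α ι : Type*}

open Classical in
/-- The indicator of the event that the random set `S` contains none of the sets `A i`, `i ∈ J`. -/
noncomputable def avoid (A : ι → Finset α) (J : Finset ι) (S : Finset α) : ℝ :=
  if ∀ i ∈ J, ¬ A i ⊆ S then 1 else 0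

lemma avoid_nonneg (A : ι → Finset α) (J : Finset ι) (S : Finset α) : 0 ≤ avoid A J S := by
  unfold avoid; split_ifs <;> simp

lemma avoid_anti_index (A : ι → Finset α) {J J' : Finset ι} (h : J ⊆ J') (S : Finset α) :
    avoid A J' S ≤ avoid A J S := by
  unfold avoid
  split_ifs with h1 h2
  · simp
  · exact absurd (fun i hi => h1 i (h hi)) h2
  · simp
  · simp

lemma avoid_anti (A : ι → Finset α) (J : Finset ι) {S S' : Finset α} (h : S ⊆ S') :
    avoid A J S' ≤ avoid A J S := by
  unfold avoid
  split_ifs with h1 h2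
  · simp
  · exact absurd (fun i hi hS => h1 i hi (hS.trans h)) h2
  · simp
  · simp

variable [Fintype α] [DecidableEq α]

/-- The expectation of `f S`, where `S` is the random subset of `α` that contains each `a`
independently with probability `p a`. -/
def bernExp (p : α → ℝ) (f : Finset α → ℝ) : ℝ :=
  ∑ S : Finset α, (∏ a ∈ S, p a) * (∏ a ∈ Sᶜ, (1 - p a)) * f S

variable {p : α → ℝ}

lemma bernExp_const (c : ℝ) : bernExp p (fun _ => c) = c := by
  unfold bernExp
  rw [← Finset.sum_mul]
  have h := Finset.prod_add p (fun a => 1 - p a) Finset.univ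
  simp only [add_sub_cancel, Finset.prod_const_one, Finset.powerset_univ] at h
  simp only [Finset.compl_eq_univ_sdiff]
  rw [← h, one_mul]

lemma bernExp_add (f g : Finset α → ℝ) :
    bernExp p (fun S => f S + g S) = bernExp p f + bernExp p g := by
  simp only [bernExp, mul_add, Finset.sum_add_distrib]

lemma bernExp_smul (c : ℝ) (f : Finset α → ℝ) :
    bernExp p (fun S => c * f S) = c * bernExp p f := by
  simp only [bernExp, Finset.mul_sum]
  exact Finset.sum_congr rfl fun S _ => by ring

lemma bernExp_sum (J : Finset ι) (f : ι → Finset α → ℝ) :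
    bernExp p (fun S => ∑ i ∈ J, f i S) = ∑ i ∈ J, bernExp p (f i) := by
  simp only [bernExp, Finset.mul_sum]
  exact Finset.sum_comm

lemma bernWeight_nonneg (hp : ∀ a, p a ∈ Set.Icc (0 : ℝ) 1) (S : Finset α) :
    0 ≤ (∏ a ∈ S, p a) * ∏ a ∈ Sᶜ, (1 - p a) :=
  mul_nonneg (Finset.prod_nonneg fun a _ => (hp a).1)
    (Finset.prod_nonneg fun a _ => sub_nonneg.2 (hp a).2)

lemma bernExp_mono (hp : ∀ a, p a ∈ Set.Icc (0 : ℝ) 1) {f g : Finset α → ℝ}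
    (h : ∀ S, f S ≤ g S) : bernExp p f ≤ bernExp p g :=
  Finset.sum_le_sum fun S _ => mul_le_mul_of_nonneg_left (h S) (bernWeight_nonneg hp S)

/-- Splitting off the coordinate `a`. -/
lemma bernExp_eq_split (a : α) (f : Finset α → ℝ) :
    bernExp p f = bernExp p (fun S => p a * f (insert a S) + (1 - p a) * f (S.erase a)) := by
  -- the summands for `S` and for `insert a S` are combined on both sides
  have key : ∀ g : Finset α → ℝ, bernExp p g = ∑ S ∈ (Finset.univ.erase a).powerset,
      (∏ b ∈ S, p b) * (∏ b ∈ (Finset.univ.erase a) \ S, (1 - p b)) *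
        (p a * g (insert a S) + (1 - p a) * g S) := by
    intro g
    unfold bernExp
    have h1 : (Finset.univ : Finset (Finset α)) =
        (insert a (Finset.univ.erase a)).powerset := by
      rw [Finset.insert_erase (Finset.mem_univ a), Finset.powerset_univ]
    rw [h1, Finset.sum_powerset_insert (Finset.notMem_erase a _), ← Finset.sum_add_distrib]
    refine Finset.sum_congr rfl fun S hS => ?_
    have haS : a ∉ S := fun h => by simpa using Finset.mem_powerset.1 hS h
    have e1 : Sᶜ = insert a (Finset.univ.erase a \ S) := by
      ext b; by_cases hb : b = a <;> simp_all
    have e2 : (insert a S)ᶜ = Finset.univ.erase a \ S := by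
      ext b; simp
    rw [e2, e1, Finset.prod_insert haS, Finset.prod_insert (by simp)]
    ring
  rw [key f, key]
  refine Finset.sum_congr rfl fun S hS => ?_
  have haS : a ∉ S := fun h => by simpa using Finset.mem_powerset.1 hS h
  simp only [Finset.insert_idem, Finset.erase_insert haS, Finset.erase_eq_of_notMem haS]
  ring

open Classical in
/-- If `g` does not increase when elements of `A` are added, then it is negatively correlated with
the event `A ⊆ S`. -/
lemma bernExp_subset_mul_le (hp : ∀ a, p a ∈ Set.Icc (0 : ℝ) 1) (A : Finset α)
    (g : Finset α → ℝ) (hg : ∀ a ∈ A, ∀ S, g (insert a S) ≤ g (S.erase a)) :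
    bernExp p (fun S => (if A ⊆ S then 1 else 0) * g S) ≤ (∏ a ∈ A, p a) * bernExp p g := by
  induction A using Finset.induction_on with
  | empty => simp
  | insert a A ha ih =>
    have ih' := ih fun b hb => hg b (Finset.mem_insert_of_mem hb)
    rw [Finset.prod_insert ha, mul_assoc]
    refine le_trans ?_ (mul_le_mul_of_nonneg_left ih' (hp a).1)
    rw [bernExp_eq_split a, bernExp_eq_split a (fun S => (if A ⊆ S then 1 else 0) * g S),
      ← bernExp_smul]
    refine bernExp_mono hp fun S => ?_
    have h1 : (insert a A ⊆ insert a S) ↔ A ⊆ S.erase a := by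
      rw [Finset.insert_subset_iff]
      constructor
      · rintro ⟨_, h⟩ b hb
        have := h hb
        grind
      · intro h
        exact ⟨Finset.mem_insert_self _ _, fun b hb => by have := h hb; grind⟩
    have h2 : (A ⊆ insert a S) ↔ A ⊆ S.erase a := by
      rw [← h1, Finset.insert_subset_iff]
      simp
    have h3 : ¬ (insert a A ⊆ S.erase a) := fun h => by
      have := h (Finset.mem_insert_self a A)
      simp at this
    simp only [h1, h2, h3, if_false]
    split_ifs with h
    · have := hg a (Finset.mem_insert_self a A) S
      have h0 := (hp a).1
      have h4 := (hp a).2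
      have h5 : 0 ≤ p a * (1 - p a) := mul_nonneg h0 (by linarith)
      nlinarith
    · simp

open Classical in
/-- If `g` does not depend on the elements of `A`, then it is independent of the event `A ⊆ S`. -/
lemma bernExp_subset_mul (hp : ∀ a, p a ∈ Set.Icc (0 : ℝ) 1) (A : Finset α)
    (g : Finset α → ℝ) (hg : ∀ a ∈ A, ∀ S, g (insert a S) = g (S.erase a)) :
    bernExp p (fun S => (if A ⊆ S then 1 else 0) * g S) = (∏ a ∈ A, p a) * bernExp p g := by
  refine le_antisymm (bernExp_subset_mul_le hp A g fun a ha S => (hg a ha S).le) ?_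
  have h := bernExp_subset_mul_le hp A (fun S => -1 * g S) fun a ha S => by rw [hg a ha S]
  have e : (fun S : Finset α => (if A ⊆ S then (1 : ℝ) else 0) * (-1 * g S)) =
      fun S => -1 * ((if A ⊆ S then 1 else 0) * g S) := by
    funext S; ring
  rw [e, bernExp_smul, bernExp_smul] at h
  linarith

open Classical in
lemma bernExp_subset (hp : ∀ a, p a ∈ Set.Icc (0 : ℝ) 1) (A : Finset α) :
    bernExp p (fun S => if A ⊆ S then 1 else 0) = ∏ a ∈ A, p a := by
  have := bernExp_subset_mul hp A (fun _ => 1) fun _ _ _ => rfl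
  simpa [bernExp_const] using this

open Classical in
/-- The conditional probability step of Janson's inequality. -/
lemma bernExp_avoid_insert_le [DecidableEq ι] (hp : ∀ a, p a ∈ Set.Icc (0 : ℝ) 1)
    (A : ι → Finset α) (J : Finset ι) (i : ι) :
    bernExp p (avoid A (insert i J)) ≤ bernExp p (avoid A J) *
      Real.exp (-(∏ a ∈ A i, p a) +
        ∑ j ∈ J with ¬ Disjoint (A i) (A j), ∏ a ∈ A i ∪ A j, p a) := by
  set N := J.filter fun j => Disjoint (A i) (A j) with hN
  set D := J.filter fun j => ¬ Disjoint (A i) (A j) with hD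
  set x := (∏ a ∈ A i, p a) - ∑ j ∈ D, ∏ a ∈ A i ∪ A j, p a with hx
  -- pointwise inclusion-exclusion
  have hpt : ∀ S, (if A i ⊆ S then 1 else 0) * avoid A N S ≤
      (avoid A J S - avoid A (insert i J) S) +
        ∑ j ∈ D, (if A i ∪ A j ⊆ S then 1 else 0) * avoid A N S := by
    intro S
    have hsum : ∀ j ∈ D, 0 ≤ (if A i ∪ A j ⊆ S then (1 : ℝ) else 0) * avoid A N S := fun j _ =>
      mul_nonneg (by split_ifs <;> simp) (avoid_nonneg _ _ _)
    have hmono := avoid_anti_index A (Finset.subset_insert i J) S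
    by_cases hi : A i ⊆ S
    · by_cases hNS : ∀ j ∈ N, ¬ A j ⊆ S
      · by_cases hDS : ∃ j ∈ D, A j ⊆ S
        · obtain ⟨j, hj, hjS⟩ := hDS
          have h1 := Finset.single_le_sum hsum hj
          have h2 : (if A i ∪ A j ⊆ S then (1 : ℝ) else 0) = 1 :=
            if_pos (Finset.union_subset hi hjS)
          rw [h2] at h1
          rw [if_pos hi]
          linarith
        · have h1 : avoid A J S = 1 := by
            unfold avoid
            refine if_pos fun j hj hjS => ?_
            by_cases hd : Disjoint (A i) (A j)
            · exact hNS j (Finset.mem_filter.2 ⟨hj, hd⟩) hjS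
            · exact hDS ⟨j, Finset.mem_filter.2 ⟨hj, hd⟩, hjS⟩
          have h2 : avoid A (insert i J) S = 0 := by
            unfold avoid
            exact if_neg fun h => h i (Finset.mem_insert_self i J) hi
          have h3 : avoid A N S = 1 := if_pos hNS
          rw [h1, h2, h3, if_pos hi]
          have := Finset.sum_nonneg hsum
          rw [h3] at this
          linarith
      · have h3 : avoid A N S = 0 := if_neg hNS
        rw [h3] at hsum ⊢
        have := Finset.sum_nonneg hsum
        linarith
    · rw [if_neg hi]
      have := Finset.sum_nonneg hsum
      linarith
  have h1 := bernExp_mono hp hpt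
  have h2 : bernExp p (fun S => (if A i ⊆ S then 1 else 0) * avoid A N S) =
      (∏ a ∈ A i, p a) * bernExp p (avoid A N) := by
    refine bernExp_subset_mul hp _ _ fun a ha S => ?_
    unfold avoid
    congr 1
    refine propext (forall₂_congr fun j hj => not_congr ?_)
    have haj : a ∉ A j := Finset.disjoint_left.1 (Finset.mem_filter.1 hj).2 ha
    constructor
    · intro h b hb
      have := h hb
      grind
    · intro h b hb
      have := h hb
      grind
  have h3 : ∀ j ∈ D, bernExp p (fun S => (if A i ∪ A j ⊆ S then 1 else 0) * avoid A N S) ≤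
      (∏ a ∈ A i ∪ A j, p a) * bernExp p (avoid A N) := fun j _ =>
    bernExp_subset_mul_le hp _ _ fun a _ S =>
      avoid_anti A N ((Finset.erase_subset a S).trans (Finset.subset_insert a S))
  have hsub : (fun S => avoid A J S - avoid A (insert i J) S) =
      fun S => avoid A J S + (-1) * avoid A (insert i J) S := by
    funext S; ring
  rw [bernExp_add, bernExp_sum, h2, hsub, bernExp_add, bernExp_smul] at h1
  have h4 := Finset.sum_le_sum h3
  rw [← Finset.sum_mul] at h4
  have hJN : bernExp p (avoid A J) ≤ bernExp p (avoid A N) :=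
    bernExp_mono hp fun S => avoid_anti_index A (Finset.filter_subset _ _) S
  have hJ0 : 0 ≤ bernExp p (avoid A J) := by
    have := bernExp_mono hp (f := fun _ => 0) (avoid_nonneg A J)
    rwa [bernExp_const] at this
  have hins : bernExp p (avoid A (insert i J)) ≤ bernExp p (avoid A J) :=
    bernExp_mono hp fun S => avoid_anti_index A (Finset.subset_insert i J) S
  have h5 : bernExp p (avoid A (insert i J)) ≤ bernExp p (avoid A J) * (1 - x) := by
    by_cases hx0 : 0 ≤ x
    · have : x * bernExp p (avoid A J) ≤ x * bernExp p (avoid A N) :=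
        mul_le_mul_of_nonneg_left hJN hx0
      have e : x * bernExp p (avoid A N) = (∏ a ∈ A i, p a) * bernExp p (avoid A N) -
        (∑ j ∈ D, ∏ a ∈ A i ∪ A j, p a) * bernExp p (avoid A N) := by rw [hx]; ring
      linarith
    · have : 0 ≤ bernExp p (avoid A J) * (-x) := mul_nonneg hJ0 (by linarith)
      linarith
  refine h5.trans (mul_le_mul_of_nonneg_left ?_ hJ0)
  have := Real.add_one_le_exp (-x)
  have e : -x = -(∏ a ∈ A i, p a) + ∑ j ∈ D, ∏ a ∈ A i ∪ A j, p a := by rw [hx]; ring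
  rw [e] at this
  linarith

open Classical in
/-- The exponent in Janson's inequality, when the sets `A i` are sampled with weights `θ i`. -/
noncomputable def jansonExponent [DecidableEq ι] (p : α → ℝ) (A : ι → Finset α) (θ : ι → ℝ)
    (J : Finset ι) : ℝ :=
  -(∑ i ∈ J, θ i * ∏ a ∈ A i, p a) +
    (∑ i ∈ J, ∑ j ∈ J with i ≠ j ∧ ¬ Disjoint (A i) (A j),
      θ i * θ j * ∏ a ∈ A i ∪ A j, p a) / 2

/-- **Janson's inequality**, in the Boppana–Spencer form. -/
lemma bernExp_avoid_le_exp [DecidableEq ι] (hp : ∀ a, p a ∈ Set.Icc (0 : ℝ) 1)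
    (A : ι → Finset α) (J : Finset ι) :
    bernExp p (avoid A J) ≤ Real.exp (jansonExponent p A (fun _ => 1) J) := by
  classical
  induction J using Finset.induction_on with
  | empty =>
    have : avoid A (∅ : Finset ι) = fun _ => 1 := by funext S; simp [avoid]
    simp [this, bernExp_const, jansonExponent]
  | insert i J hi ih =>
    refine (bernExp_avoid_insert_le hp A J i).trans ?_
    refine (mul_le_mul_of_nonneg_right ih (Real.exp_pos _).le).trans ?_
    rw [← Real.exp_add]
    refine le_of_eq (congrArg Real.exp ?_)
    have hrow : (insert i J).filter (fun j => i ≠ j ∧ ¬ Disjoint (A i) (A j)) =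
        J.filter fun j => ¬ Disjoint (A i) (A j) := by
      ext j
      simp only [Finset.mem_filter, Finset.mem_insert]
      constructor
      · rintro ⟨h1 | h1, h2, h3⟩
        · exact absurd h1.symm h2
        · exact ⟨h1, h3⟩
      · rintro ⟨h1, h2⟩
        exact ⟨Or.inr h1, fun h => hi (h ▸ h1), h2⟩
    have hcol : ∀ k ∈ J, ∑ j ∈ insert i J with k ≠ j ∧ ¬ Disjoint (A k) (A j),
          ∏ a ∈ A k ∪ A j, p a =
        (if ¬ Disjoint (A i) (A k) then ∏ a ∈ A i ∪ A k, p a else 0) +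
        ∑ j ∈ J with k ≠ j ∧ ¬ Disjoint (A k) (A j), ∏ a ∈ A k ∪ A j, p a := by
      intro k hk
      have hki : k ≠ i := fun h => hi (h ▸ hk)
      rw [Finset.sum_filter, Finset.sum_insert hi, ← Finset.sum_filter]
      simp only [ne_eq, hki, not_false_eq_true, true_and, disjoint_comm (a := A k) (b := A i),
        Finset.union_comm (A k) (A i)]
    simp only [jansonExponent, one_mul]
    rw [Finset.sum_insert hi, Finset.sum_insert hi, hrow, Finset.sum_congr rfl hcol,
      Finset.sum_add_distrib, ← Finset.sum_filter]
    ring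

/-- Janson's inequality with weights: averaging the previous inequality over a random subfamily
that contains the index `i` with probability `θ i`. -/
theorem bernExp_avoid_le_exp_weighted [Fintype ι] [DecidableEq ι]
    (hp : ∀ a, p a ∈ Set.Icc (0 : ℝ) 1) (A : ι → Finset α) (θ : ι → ℝ)
    (hθ : ∀ i, θ i ∈ Set.Icc (0 : ℝ) 1) :
    bernExp p (avoid A Finset.univ) ≤ Real.exp (jansonExponent p A θ Finset.univ) := by
  classical
  have key : bernExp θ (jansonExponent p A fun _ => 1) = jansonExponent p A θ Finset.univ := by
    have e : jansonExponent p A (fun _ => 1) = fun J : Finset ι =>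
        (∑ i, (-∏ a ∈ A i, p a) * (if {i} ⊆ J then 1 else 0)) +
        ∑ i, ∑ j, (if i ≠ j ∧ ¬ Disjoint (A i) (A j) then (∏ a ∈ A i ∪ A j, p a) / 2 else 0) *
          (if {i, j} ⊆ J then 1 else 0) := by
      funext J
      simp only [jansonExponent, one_mul]
      congr 1
      · rw [← Finset.sum_neg_distrib]
        simp [Finset.sum_ite_mem]
      · rw [Finset.sum_div, ← Finset.sum_subset (Finset.subset_univ J)]
        · refine Finset.sum_congr rfl fun i hi => ?_
          rw [Finset.sum_filter, Finset.sum_div, ← Finset.sum_subset (Finset.subset_univ J)]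
          · refine Finset.sum_congr rfl fun j hj => ?_
            have : {i, j} ⊆ J := by
              intro x; simp only [Finset.mem_insert, Finset.mem_singleton]
              rintro (rfl | rfl) <;> assumption
            rw [if_pos this, mul_one, ite_div, zero_div]
          · intro j _ hj
            have : ¬ {i, j} ⊆ J := fun h => hj (h (by simp))
            rw [if_neg this, mul_zero]
        · intro i _ hi
          refine Finset.sum_eq_zero fun j _ => ?_
          have : ¬ {i, j} ⊆ J := fun h => hi (h (by simp))
          rw [if_neg this, mul_zero]
    rw [e, bernExp_add, bernExp_sum, bernExp_sum]
    simp only [bernExp_sum, bernExp_smul, bernExp_subset hθ, Finset.prod_singleton]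
    rw [jansonExponent]
    congr 1
    · rw [← Finset.sum_neg_distrib]
      exact Finset.sum_congr rfl fun i _ => by ring
    · rw [Finset.sum_div]
      refine Finset.sum_congr rfl fun i _ => ?_
      rw [Finset.sum_filter, Finset.sum_div]
      refine Finset.sum_congr rfl fun j _ => ?_
      split_ifs with h
      · rw [Finset.prod_pair h.1]; ring
      · simp
  obtain ⟨J, hJ⟩ : ∃ J, jansonExponent p A (fun _ => 1) J ≤ jansonExponent p A θ Finset.univ := by
    by_contra! hcon
    obtain ⟨J₀, -, h₀⟩ := Finset.exists_min_image (Finset.univ : Finset (Finset ι))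
      (jansonExponent p A fun _ => 1) ⟨∅, Finset.mem_univ _⟩
    have := bernExp_mono hθ (f := fun _ => jansonExponent p A (fun _ => 1) J₀)
      fun S => h₀ S (Finset.mem_univ S)
    rw [bernExp_const, key] at this
    exact absurd (hcon J₀) (not_lt.2 this)
  calc bernExp p (avoid A Finset.univ) ≤ bernExp p (avoid A J) :=
        bernExp_mono hp fun S => avoid_anti_index A (Finset.subset_univ J) S
    _ ≤ _ := bernExp_avoid_le_exp hp A J
    _ ≤ _ := Real.exp_le_exp.2 hJ

end Janson

/-! ### Haxell's matching theorem for hypergraphs -/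

section Haxell

variable {A B : Type*}

/-- `M` assigns to the elements `a ∈ A'` pairwise disjoint members of the families `𝓕 a`. -/
def IsPartialRep (𝓕 : A → Set (Finset B)) (A' : Finset A) (M : A → Finset B) : Prop :=
  (∀ a ∈ A', M a ∈ 𝓕 a) ∧ ∀ a ∈ A', ∀ b ∈ A', a ≠ b → Disjoint (M a) (M b)

variable [DecidableEq A]

lemma IsPartialRep.update {𝓕 : A → Set (Finset B)} {A' : Finset A}
    {M : A → Finset B} (hM : IsPartialRep 𝓕 A' M) {a : A} {F : Finset B} (hF : F ∈ 𝓕 a)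
    (hd : ∀ b ∈ A', b ≠ a → Disjoint F (M b)) :
    IsPartialRep 𝓕 (insert a A') (Function.update M a F) := by
  refine ⟨fun b hb => ?_, fun b hb c hc hbc => ?_⟩
  · by_cases h : b = a
    · subst h; simpa using hF
    · rw [Function.update_of_ne h]
      exact hM.1 b (Finset.mem_of_mem_insert_of_ne hb h)
  · by_cases h : b = a
    · subst h
      rw [Function.update_self, Function.update_of_ne hbc.symm]
      exact hd c (Finset.mem_of_mem_insert_of_ne hc hbc.symm) hbc.symm
    · rw [Function.update_of_ne h]
      by_cases h' : c = a
      · subst h'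
        rw [Function.update_self]
        exact (hd b (Finset.mem_of_mem_insert_of_ne hb h) h).symm
      · rw [Function.update_of_ne h']
        exact hM.2 b (Finset.mem_of_mem_insert_of_ne hb h) c
          (Finset.mem_of_mem_insert_of_ne hc h') hbc

/-- A stage in the growth of an alternating tree rooted at the unmatched element `a₀`: `C` is the
set of elements in the tree, `X` the set of points used by it, and `𝓜` the set of matchings of `A'`
that are compatible with the tree. The field `no_swap` says that no element of the tree can be
rematched without conflicts; it holds because the tree is built with as few conflicts as possible.
-/
structure IsTreeStage (𝓕 : A → Set (Finset B)) (A' : Finset A) (a₀ : A) (s : ℕ)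
    (C : Finset A) (X : Finset B) (𝓜 : Set (A → Finset B)) : Prop where
  root_mem : a₀ ∈ C
  subset : ∀ c ∈ C, c ≠ a₀ → c ∈ A'
  nonempty : 𝓜.Nonempty
  isPartialRep : ∀ M ∈ 𝓜, IsPartialRep 𝓕 A' M
  used : ∀ M ∈ 𝓜, ∀ c ∈ C, c ≠ a₀ → M c ⊆ X
  card_le : X.card ≤ 2 * s * (C.card - 1)
  update_mem : ∀ M ∈ 𝓜, ∀ a ∈ A', a ∉ C → ∀ F ∈ 𝓕 a, Disjoint F X →
    (∀ b ∈ A', b ≠ a → Disjoint F (M b)) → Function.update M a F ∈ 𝓜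
  no_swap : ∀ M ∈ 𝓜, ∀ a ∈ C, ∀ F ∈ 𝓕 a, Disjoint F X → ∃ b ∈ A', b ∉ C ∧ ¬ Disjoint F (M b)

lemma IsTreeStage.exists_grow {𝓕 : A → Set (Finset B)} {A' : Finset A} {a₀ : A} {s : ℕ}
    (ha₀ : a₀ ∉ A') (hcard : ∀ a, ∀ F ∈ 𝓕 a, F.card ≤ s)
    (hhall : ∀ C : Finset A, C ⊆ insert a₀ A' → C.Nonempty → ∀ X : Finset B,
      X.card ≤ 2 * s * (C.card - 1) → ∃ a ∈ C, ∃ F ∈ 𝓕 a, Disjoint F X)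
    {C : Finset A} {X : Finset B} {𝓜 : Set (A → Finset B)}
    (h : IsTreeStage 𝓕 A' a₀ s C X 𝓜) :
    ∃ C' X' 𝓜', C.card < C'.card ∧ IsTreeStage 𝓕 A' a₀ s C' X' 𝓜' := by
  classical
  let blockers : (A → Finset B) → Finset B → Finset A := fun M F =>
    A'.filter fun b => b ∉ C ∧ ¬ Disjoint F (M b)
  -- the set of possible numbers of conflicts of an extension of the tree
  let P : ℕ → Prop := fun d => ∃ M ∈ 𝓜, ∃ a ∈ C, ∃ F ∈ 𝓕 a, Disjoint F X ∧
    (blockers M F).card = d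
  have hP : ∃ d, P d := by
    obtain ⟨M, hM⟩ := h.nonempty
    have hC : C ⊆ insert a₀ A' := fun c hc => by
      by_cases hc0 : c = a₀
      · exact hc0 ▸ Finset.mem_insert_self _ _
      · exact Finset.mem_insert_of_mem (h.subset c hc hc0)
    obtain ⟨a, ha, F, hF, hFX⟩ := hhall C hC ⟨a₀, h.root_mem⟩ X h.card_le
    exact ⟨_, M, hM, a, ha, F, hF, hFX, rfl⟩
  obtain ⟨M, hM, a, ha, F, hF, hFX, hd⟩ := Nat.find_spec hP
  have hmin : ∀ M' ∈ 𝓜, (blockers M F).card ≤ (blockers M' F).card := fun M' hM' => by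
    rw [hd]
    exact Nat.find_min' hP ⟨M', hM', a, ha, F, hF, hFX, rfl⟩
  set Bl := blockers M F with hBl
  have hBlmem : ∀ b, b ∈ Bl ↔ b ∈ A' ∧ b ∉ C ∧ ¬ Disjoint F (M b) := fun b => by
    simp [hBl, blockers]
  have hBlne : Bl.Nonempty := by
    obtain ⟨b, hb, hbC, hbF⟩ := h.no_swap M hM a ha F hF hFX
    exact ⟨b, (hBlmem b).2 ⟨hb, hbC, hbF⟩⟩
  have hdisj : Disjoint C Bl := Finset.disjoint_left.2 fun c hc hc' => ((hBlmem c).1 hc').2.1 hc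
  have hCcard : (C ∪ Bl).card = C.card + Bl.card := Finset.card_union_of_disjoint hdisj
  have hCpos : 0 < C.card := Finset.card_pos.2 ⟨a₀, h.root_mem⟩
  have hBpos : 0 < Bl.card := hBlne.card_pos
  refine ⟨C ∪ Bl, X ∪ (F ∪ Bl.biUnion M),
    {M' ∈ 𝓜 | (∀ b ∈ Bl, M' b = M b) ∧ ∀ b ∈ A', b ∉ C ∪ Bl → Disjoint F (M' b)}, by omega, ?_⟩
  have hrep := h.isPartialRep M hM
  have hne0 : ∀ b ∈ A', b ≠ a₀ := fun b hb h0 => ha₀ (h0 ▸ hb)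
  constructor
  · exact Finset.mem_union_left _ h.root_mem
  · intro c hc hc0
    rcases Finset.mem_union.1 hc with hc | hc
    · exact h.subset c hc hc0
    · exact ((hBlmem c).1 hc).1
  · refine ⟨M, hM, fun _ _ => rfl, fun b hb hb' => ?_⟩
    by_contra hcon
    rw [Finset.mem_union, not_or] at hb'
    exact hb'.2 ((hBlmem b).2 ⟨hb, hb'.1, hcon⟩)
  · exact fun M' hM' => h.isPartialRep M' hM'.1
  · intro M' hM' c hc hc0
    rcases Finset.mem_union.1 hc with hc | hc
    · exact (h.used M' hM'.1 c hc hc0).trans Finset.subset_union_left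
    · rw [hM'.2.1 c hc]
      exact (Finset.subset_biUnion_of_mem M hc).trans
        (Finset.subset_union_right.trans Finset.subset_union_right)
  · have h1 : (Bl.biUnion M).card ≤ Bl.card * s :=
      Finset.card_biUnion_le_card_mul _ _ _ fun b hb => hcard b _ (hrep.1 b ((hBlmem b).1 hb).1)
    have h2 := Finset.card_union_le X (F ∪ Bl.biUnion M)
    have h3 := Finset.card_union_le F (Bl.biUnion M)
    have h4 := hcard a F hF
    have h5 := h.card_le
    have h6 : (C ∪ Bl).card - 1 = (C.card - 1) + Bl.card := by omega
    have h7 : s ≤ Bl.card * s := Nat.le_mul_of_pos_left s hBpos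
    rw [h6]
    nlinarith
  · intro M' hM' a' ha' ha'C F' hF' hF'X hF'd
    rw [Finset.mem_union, not_or] at ha'C
    have hX : Disjoint F' X := hF'X.mono_right Finset.subset_union_left
    have hFF : Disjoint F F' := (hF'X.mono_right
      (Finset.subset_union_left.trans Finset.subset_union_right)).symm
    refine ⟨h.update_mem M' hM'.1 a' ha' ha'C.1 F' hF' hX hF'd, fun b hb => ?_, fun b hb hb' => ?_⟩
    · rw [Function.update_of_ne (show b ≠ a' from fun h0 => ha'C.2 (h0 ▸ hb))]
      exact hM'.2.1 b hb
    · by_cases hba : b = a'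
      · subst hba; rwa [Function.update_self]
      · rw [Function.update_of_ne hba]; exact hM'.2.2 b hb hb'
  · intro M' hM' a' ha' F' hF' hF'X
    by_contra! hcon
    have hX : Disjoint F' X := hF'X.mono_right Finset.subset_union_left
    have hFF : Disjoint F F' := (hF'X.mono_right
      (Finset.subset_union_left.trans Finset.subset_union_right)).symm
    -- `F'` meets the matching `M'` at most in the tree
    have hall : ∀ b ∈ A', b ∉ C → Disjoint F' (M' b) := fun b hb hbC => by
      by_cases hbB : b ∈ Bl
      · rw [hM'.2.1 b hbB]
        exact hF'X.mono_right ((Finset.subset_biUnion_of_mem M hbB).trans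
          (Finset.subset_union_right.trans Finset.subset_union_right))
      · exact hcon b hb (by simp [hbC, hbB])
    rcases Finset.mem_union.1 ha' with ha'C | ha'B
    · obtain ⟨b, hb, hbC, hbF⟩ := h.no_swap M' hM'.1 a' ha'C F' hF' hX
      exact hbF (hall b hb hbC)
    · -- rematching `a'` to `F'` would remove a conflict, against the minimal choice
      have ha'A := ((hBlmem a').1 ha'B).1
      have ha'C := ((hBlmem a').1 ha'B).2.1
      have hup := h.update_mem M' hM'.1 a' ha'A ha'C F' hF' hX fun b hb _ => by
        by_cases hbC : b ∈ C
        · exact hX.mono_right (h.used M' hM'.1 b hbC (hne0 b hb))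
        · exact hall b hb hbC
      have hle := hmin _ hup
      have hsub : blockers (Function.update M' a' F') F ⊆ Bl.erase a' := by
        intro b hb
        obtain ⟨hbA, hbC, hbF⟩ := Finset.mem_filter.1 hb
        have hba : b ≠ a' := by
          rintro rfl
          rw [Function.update_self] at hbF
          exact hbF hFF
        rw [Function.update_of_ne hba] at hbF
        refine Finset.mem_erase.2 ⟨hba, ?_⟩
        by_contra hbB
        exact hbF (hM'.2.2 b hbA (by simp [hbC, hbB]))
      have := Finset.card_le_card hsub
      rw [Finset.card_erase_of_mem ha'B] at this
      omega

/-- **Haxell's theorem**: if no set of at most `2s(|C| - 1)` points meets all members of the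
families `𝓕 a`, `a ∈ C`, for any nonempty `C ⊆ A'`, then the families `𝓕 a`, `a ∈ A'`, have
pairwise disjoint representatives. -/
theorem exists_isPartialRep {𝓕 : A → Set (Finset B)} {s : ℕ} (A' : Finset A)
    (hcard : ∀ a, ∀ F ∈ 𝓕 a, F.card ≤ s)
    (hhall : ∀ C : Finset A, C ⊆ A' → C.Nonempty → ∀ X : Finset B,
      X.card ≤ 2 * s * (C.card - 1) → ∃ a ∈ C, ∃ F ∈ 𝓕 a, Disjoint F X) :
    ∃ M, IsPartialRep 𝓕 A' M := by
  classical
  induction A' using Finset.induction_on with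
  | empty => exact ⟨fun _ => ∅, by simp [IsPartialRep]⟩
  | insert a₀ A' ha₀ ih =>
    obtain ⟨M₀, hM₀⟩ := ih fun C hC => hhall C (hC.trans (Finset.subset_insert _ _))
    by_contra hno
    -- an alternating tree that grows forever
    have key : ∀ t : ℕ, ∃ C X 𝓜, t ≤ C.card ∧ IsTreeStage 𝓕 A' a₀ s C X 𝓜 := by
      intro t
      induction t with
      | zero =>
        refine ⟨{a₀}, ∅, {M | IsPartialRep 𝓕 A' M}, Nat.zero_le _, ?_⟩
        constructor
        · simp
        · simp
        · exact ⟨M₀, hM₀⟩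
        · exact fun _ h => h
        · simp
        · simp
        · intro M hM a ha _ F hF _ hd
          have := IsPartialRep.update hM hF hd
          rwa [Finset.insert_eq_of_mem ha] at this
        · intro M hM a ha F hF _
          rw [Finset.mem_singleton] at ha
          subst ha
          by_contra! hcon
          exact hno ⟨_, IsPartialRep.update hM hF fun b hb hba => hcon b hb (by simpa using hba)⟩
      | succ t iht =>
        obtain ⟨C, X, 𝓜, ht, h⟩ := iht
        obtain ⟨C', X', 𝓜', hlt, h'⟩ := h.exists_grow ha₀ hcard hhall
        exact ⟨C', X', 𝓜', by omega, h'⟩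
    obtain ⟨C, X, 𝓜, ht, h⟩ := key (A'.card + 2)
    have hsub : C ⊆ insert a₀ A' := fun c hc => by
      by_cases hc0 : c = a₀
      · exact hc0 ▸ Finset.mem_insert_self _ _
      · exact Finset.mem_insert_of_mem (h.subset c hc hc0)
    have := Finset.card_le_card hsub
    rw [Finset.card_insert_of_notMem ha₀] at this
    omega

end Haxell

/-! ### Binomial random graphs -/

section RandomGraph

variable {V : Type*}

instance [Finite V] : MeasurableSingletonClass (SimpleGraph V) where
  measurableSet_singleton G := by
    have : ({G} : Set (SimpleGraph V)) = SimpleGraph.edgeSet ⁻¹' {G.edgeSet} := by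
      ext G'; simp
    rw [this]
    exact SimpleGraph.measurable_edgeSet (measurableSet_singleton _)

open Classical in
/-- The probability that a pair of vertices is an edge of the binomial random graph: `q`, or `0` for
a diagonal pair. -/
noncomputable def edgeProb (V : Type*) (q : unitInterval) (e : Sym2 V) : ℝ :=
  if e.IsDiag then 0 else q

lemma edgeProb_mem (q : unitInterval) (e : Sym2 V) : edgeProb V q e ∈ Set.Icc (0 : ℝ) 1 := by
  unfold edgeProb
  split_ifs
  · simp
  · exact q.2

lemma binomialRandom_real_singleton [Fintype V] [DecidableEq V] (q : unitInterval)
    (G : SimpleGraph V) [Fintype G.edgeSet] :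
    (SimpleGraph.binomialRandom V q).real {G} =
      (∏ e ∈ G.edgeFinset, edgeProb V q e) * ∏ e ∈ G.edgeFinsetᶜ, (1 - edgeProb V q e) := by
  classical
  have h1 : ∏ e ∈ G.edgeFinset, edgeProb V q e = (q : ℝ) ^ G.edgeFinset.card := by
    refine Finset.prod_eq_pow_card fun e he => ?_
    have := G.not_isDiag_of_mem_edgeFinset he
    simp [edgeProb, this]
  have h2 : ∏ e ∈ G.edgeFinsetᶜ, (1 - edgeProb V q e) =
      (1 - (q : ℝ)) ^ ((Nat.card V).choose 2 - G.edgeFinset.card) := by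
    rw [← Finset.prod_filter_mul_prod_filter_not G.edgeFinsetᶜ (fun e => e.IsDiag)]
    rw [Finset.prod_eq_one fun e he => by simp [edgeProb, (Finset.mem_filter.1 he).2], one_mul]
    rw [Finset.prod_eq_pow_card (b := 1 - (q : ℝ)) fun e he => by
      simp [edgeProb, (Finset.mem_filter.1 he).2]]
    congr 1
    have h3 : (Finset.univ.filter fun e : Sym2 V => ¬ e.IsDiag).card = (Nat.card V).choose 2 := by
      rw [Nat.card_eq_fintype_card, ← Sym2.card_diagSet_compl, Fintype.card_subtype]
      congr 1
    rw [← h3, ← Finset.card_sdiff_of_subset]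
    · congr 1
      ext e
      simp [and_comm]
    · intro e he
      simpa using G.not_isDiag_of_mem_edgeFinset he
  rw [h1, h2, measureReal_def, SimpleGraph.binomialRandom_singleton]
  have h4 : G.edgeSet.ncard = G.edgeFinset.card := by
    rw [← SimpleGraph.coe_edgeFinset, Set.ncard_coe_finset]
  rw [h4]
  simp [ENNReal.toReal_mul, ENNReal.toReal_pow]

lemma binomialRandom_singleton_ne_zero [Finite V] {q : unitInterval} (h0 : 0 < q) (h1 : q < 1)
    (G : SimpleGraph V) : SimpleGraph.binomialRandom V q {G} ≠ 0 := by
  have hq : unitInterval.toNNReal q ≠ 0 := by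
    intro h
    exact h0.ne' (by ext; simpa using congrArg NNReal.toReal h)
  have hq' : unitInterval.toNNReal (unitInterval.symm q) ≠ 0 := by
    intro h
    have := congrArg NNReal.toReal h
    simp only [unitInterval.coe_toNNReal, unitInterval.coe_symm_eq, NNReal.coe_zero] at this
    have h1' : (q : ℝ) < 1 := h1
    linarith
  rw [SimpleGraph.binomialRandom_singleton]
  exact mul_ne_zero (pow_ne_zero _ (by exact_mod_cast hq)) (pow_ne_zero _ (by exact_mod_cast hq'))

/-- The probability that a binomial random graph contains none of the edge sets `A i` is at most
the corresponding probability for the Bernoulli random subset of all pairs. -/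
lemma binomialRandom_avoid_le {ι : Type*} [Fintype ι] [Fintype V] [DecidableEq V]
    (q : unitInterval) (A : ι → Finset (Sym2 V)) :
    (SimpleGraph.binomialRandom V q).real {G | ∀ i, ¬ (A i : Set (Sym2 V)) ⊆ G.edgeSet} ≤
      bernExp (edgeProb V q) (avoid A Finset.univ) := by
  classical
  set 𝒢 : Finset (SimpleGraph V) :=
    Finset.univ.filter fun G => ∀ i, ¬ (A i : Set (Sym2 V)) ⊆ G.edgeSet with h𝒢
  have e : {G : SimpleGraph V | ∀ i, ¬ (A i : Set (Sym2 V)) ⊆ G.edgeSet} = 𝒢 := by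
    ext G; simp [h𝒢]
  rw [e, ← sum_measureReal_singleton]
  unfold bernExp
  have hinj : Set.InjOn (fun G : SimpleGraph V => G.edgeFinset) (𝒢 : Set (SimpleGraph V)) :=
    fun G _ G' _ h => SimpleGraph.edgeFinset_inj.1 h
  refine le_trans (le_of_eq ?_) (Finset.sum_le_univ_sum_of_nonneg (s := 𝒢.image
    fun G => G.edgeFinset) fun S => mul_nonneg (bernWeight_nonneg (edgeProb_mem q) S)
      (avoid_nonneg A _ S))
  rw [Finset.sum_image hinj]
  refine Finset.sum_congr rfl fun G hG => ?_
  have h1 : avoid A Finset.univ G.edgeFinset = 1 := by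
    unfold avoid
    refine if_pos fun i _ hi => (Finset.mem_filter.1 hG).2 i ?_
    rw [← SimpleGraph.coe_edgeFinset]
    exact_mod_cast hi
  rw [h1, mul_one, binomialRandom_real_singleton]

/-- Conditioning on the first graphs does not change the law of a later one. -/
lemma cond_roundsLaw_real {n k : ℕ} {q : unitInterval} (h0 : 0 < q) (h1 : q < 1) (h : Fin k)
    (g : Fin (k + 1) → SimpleGraph (Fin n)) (𝓔 : Set (SimpleGraph (Fin n))) :
    (ProbabilityTheory.cond (roundsLaw n k q) {G | ∀ i ≤ h.castSucc, G i = g i}).real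
      {G | G h.succ ∈ 𝓔} = (SimpleGraph.binomialRandom (Fin n) q).real 𝓔 := by
  classical
  set μ := SimpleGraph.binomialRandom (Fin n) q
  let s : Fin (k + 1) → Set (SimpleGraph (Fin n)) := fun i =>
    if i ≤ h.castSucc then {g i} else Set.univ
  have hC : {G : Fin (k + 1) → SimpleGraph (Fin n) | ∀ i ≤ h.castSucc, G i = g i} =
      Set.pi Set.univ s := by
    ext G
    simp only [Set.mem_ofPred_eq, Set.mem_pi, Set.mem_univ, true_imp_iff, s]
    refine forall_congr' fun i => ?_
    split_ifs with hi <;> simp [hi]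
  have hsucc : ¬ h.succ ≤ h.castSucc := by simp [Fin.le_def]
  have hCD : {G : Fin (k + 1) → SimpleGraph (Fin n) | ∀ i ≤ h.castSucc, G i = g i} ∩
      {G | G h.succ ∈ 𝓔} = Set.pi Set.univ (Function.update s h.succ 𝓔) := by
    ext G
    rw [hC]
    simp only [Set.mem_inter_iff, Set.mem_ofPred_eq, Set.mem_pi, Set.mem_univ, true_imp_iff]
    constructor
    · rintro ⟨hG, hE⟩ i
      by_cases hi : i = h.succ
      · subst hi; simpa using hE
      · rw [Function.update_of_ne hi]; exact hG i
    · intro hG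
      refine ⟨fun i => ?_, by simpa using hG h.succ⟩
      by_cases hi : i = h.succ
      · subst hi; simp [s, hsucc]
      · have := hG i; rwa [Function.update_of_ne hi] at this
  have hms : MeasurableSet {G : Fin (k + 1) → SimpleGraph (Fin n) | ∀ i ≤ h.castSucc, G i = g i} :=
    (Set.toFinite _).measurableSet
  have hs0 : ∀ i, μ (s i) ≠ 0 := fun i => by
    simp only [s]
    split_ifs
    · exact binomialRandom_singleton_ne_zero h0 h1 _
    · simp [μ]
  have hprod : (roundsLaw n k q) (Set.pi Set.univ (Function.update s h.succ 𝓔)) =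
      (roundsLaw n k q) (Set.pi Set.univ s) * μ 𝓔 := by
    unfold roundsLaw
    rw [Measure.pi_pi, Measure.pi_pi, ← Finset.mul_prod_erase _ _ (Finset.mem_univ h.succ),
      ← Finset.mul_prod_erase Finset.univ (fun i => μ (s i)) (Finset.mem_univ h.succ)]
    have : ∏ i ∈ Finset.univ.erase h.succ, μ (Function.update s h.succ 𝓔 i) =
        ∏ i ∈ Finset.univ.erase h.succ, μ (s i) :=
      Finset.prod_congr rfl fun i hi => by rw [Function.update_of_ne (Finset.ne_of_mem_erase hi)]
    rw [this, Function.update_self]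
    have hu : μ (s h.succ) = 1 := by simp [s, hsucc, μ]
    rw [hu, one_mul, mul_comm]
  have hne : (roundsLaw n k q) (Set.pi Set.univ s) ≠ 0 := by
    unfold roundsLaw
    rw [Measure.pi_pi]
    exact Finset.prod_ne_zero_iff.2 fun i _ => hs0 i
  have htop : (roundsLaw n k q) (Set.pi Set.univ s) ≠ ⊤ := by
    unfold roundsLaw
    exact measure_ne_top _ _
  rw [measureReal_def, cond_apply hms, hCD, hC, hprod, ← mul_assoc,
    ENNReal.inv_mul_cancel hne htop, one_mul, measureReal_def]

end RandomGraph

/-! ### Random copies of the members of a batch -/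

section Placement

variable {V W : Type*} (H : SimpleGraph V) (A : Set V)

/-- `ψ` is a copy of `S` in `Γ`, relative to the embedding `f` of the part on `A`: it extends `f`,
places `S` injectively, and sends to edges of `Γ` the edges of `H` that meet `S` and lie in
`S ∪ A`. -/
structure IsRelCopy (f : V → W) (Γ : SimpleGraph W) (S : Finset V) (ψ : V → W) : Prop where
  eq_of_mem : ∀ v ∈ A, ψ v = f v
  injOn : Set.InjOn ψ S
  map_adj : ∀ u ∈ S, ∀ v, (v ∈ S ∨ v ∈ A) → H.Adj u v → Γ.Adj (ψ u) (ψ v)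

open Classical in
/-- The edges of `H` that meet `T` and lie in `T ∪ A`. -/
noncomputable def relEdges [Fintype V] (T : Finset V) : Finset (Sym2 V) :=
  H.edgeFinset.filter fun e => (∃ v ∈ e, v ∈ T) ∧ ∀ v ∈ e, v ∈ T ∨ v ∈ A

open Classical in
/-- The edges of `H` inside `T`. -/
noncomputable def innerEdges [Fintype V] (T : Finset V) : Finset (Sym2 V) :=
  H.edgeFinset.filter fun e => ∀ v ∈ e, v ∈ T

open Classical in
/-- The placement of the vertices of `S` given by a position `φ j` in the part with label `j`, for
every label `j`; the remaining vertices are placed by `f`. -/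
noncomputable def place {s w : ℕ} (pos : Fin s × Fin w → W) (f : V → W) (lab : V → Fin s)
    (S : Finset V) (φ : Fin s → Fin w) (v : V) : W :=
  if v ∈ S then pos (lab v, φ (lab v)) else f v

variable {H A}

section

variable {s w : ℕ} {pos : Fin s × Fin w → W} {f : V → W} {lab lab' : V → Fin s}
  {S S' : Finset V} {φ φ' : Fin s → Fin w}

lemma place_of_mem {v : V} (hv : v ∈ S) : place pos f lab S φ v = pos (lab v, φ (lab v)) :=
  if_pos hv

lemma place_of_notMem {v : V} (hv : v ∉ S) : place pos f lab S φ v = f v := if_neg hv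

lemma place_eq_place_of_mem (hpos : Function.Injective pos)
    (hfree : ∀ x, ∀ v ∈ A, pos x ≠ f v) (hS'A : ∀ v ∈ S', v ∉ A)
    {x y : V} (hx : x ∈ S) (hy : y ∈ S' ∨ y ∈ A)
    (h : place pos f lab S φ x = place pos f lab' S' φ' y) :
    y ∈ S' ∧ lab x = lab' y ∧ φ (lab x) = φ' (lab x) := by
  rw [place_of_mem hx] at h
  rcases hy with hy | hy
  · rw [place_of_mem hy] at h
    have := hpos h
    rw [Prod.mk.injEq] at this
    exact ⟨hy, this.1, by rw [this.2, this.1]⟩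
  · rw [place_of_notMem (fun hy' => hS'A y hy' hy)] at h
    exact absurd h (hfree _ y hy)

lemma place_eq_place_of_mem_right (hf : Set.InjOn f A)
    (hfree : ∀ x, ∀ v ∈ A, pos x ≠ f v) (hSA : ∀ v ∈ S, v ∉ A)
    {x y : V} (hx : x ∈ A) (hy : y ∈ S' ∨ y ∈ A)
    (h : place pos f lab S φ x = place pos f lab' S' φ' y) : x = y := by
  rw [place_of_notMem (fun hx' => hSA x hx' hx)] at h
  by_cases hy' : y ∈ S'
  · rw [place_of_mem hy'] at h
    exact absurd h.symm (hfree _ x hx)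
  · rw [place_of_notMem hy'] at h
    exact hf hx (hy.resolve_left hy') h

variable [Fintype V]

lemma mem_relEdges {T : Finset V} {e : Sym2 V} :
    e ∈ relEdges H A T ↔ e ∈ H.edgeSet ∧ (∃ v ∈ e, v ∈ T) ∧ ∀ v ∈ e, v ∈ T ∨ v ∈ A := by
  simp [relEdges]

lemma mem_innerEdges {T : Finset V} {e : Sym2 V} :
    e ∈ innerEdges H T ↔ e ∈ H.edgeSet ∧ ∀ v ∈ e, v ∈ T := by
  simp [innerEdges]

variable [DecidableEq W]

/-- The edges required by a placement of `S`. -/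
noncomputable def placeEdges (H : SimpleGraph V) (A : Set V) (pos : Fin s × Fin w → W) (f : V → W)
    (lab : V → Fin s) (S : Finset V) (φ : Fin s → Fin w) : Finset (Sym2 W) :=
  (relEdges H A S).image (Sym2.map (place pos f lab S φ))

lemma isRelCopy_place [DecidableEq V] (hpos : Function.Injective pos)
    (hSA : ∀ v ∈ S, v ∉ A)
    (hlab : Set.InjOn lab S) {Γ : SimpleGraph W}
    (hΓ : (placeEdges H A pos f lab S φ : Set (Sym2 W)) ⊆ Γ.edgeSet) :
    IsRelCopy H A f Γ S (place pos f lab S φ) where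
  eq_of_mem v hv := place_of_notMem fun h => hSA v h hv
  injOn x hx y hy h := by
    rw [place_of_mem hx, place_of_mem hy] at h
    exact hlab hx hy (Prod.mk.inj (hpos h)).1
  map_adj u hu v hv huv := by
    have : s(u, v) ∈ relEdges H A S := by
      refine mem_relEdges.2 ⟨huv, ⟨u, by simp, hu⟩, fun x hx => ?_⟩
      rcases Sym2.mem_iff.1 hx with rfl | rfl
      · exact Or.inl hu
      · exact hv
    have h2 := hΓ (Finset.mem_coe.2 (Finset.mem_image_of_mem _ this))
    simpa using h2

lemma not_isDiag_of_mem_placeEdges (hpos : Function.Injective pos)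
    (hf : Set.InjOn f A) (hfree : ∀ x, ∀ v ∈ A, pos x ≠ f v) (hSA : ∀ v ∈ S, v ∉ A)
    (hlab : Set.InjOn lab S) {e : Sym2 W} (he : e ∈ placeEdges H A pos f lab S φ) :
    ¬ e.IsDiag := by
  obtain ⟨d, hd, rfl⟩ := Finset.mem_image.1 he
  obtain ⟨hdH, -, hdS⟩ := mem_relEdges.1 hd
  induction d using Sym2.inductionOn with
  | hf u v =>
    rw [Sym2.map_mk, Sym2.mk_isDiag_iff]
    intro h
    have huv : u ≠ v := H.ne_of_adj hdH
    rcases hdS u (by simp) with hu | hu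
    · obtain ⟨hv, hl, -⟩ := place_eq_place_of_mem hpos hfree hSA hu (hdS v (by simp)) h
      exact huv (hlab hu hv hl)
    · exact huv (place_eq_place_of_mem_right hf hfree hSA hu (hdS v (by simp)) h)

/-- A common edge of two placements of `S` comes from an edge whose vertices in `S` are placed
identically. -/
lemma placeEdges_inter_subset [DecidableEq V] (hpos : Function.Injective pos)
    (hfree : ∀ x, ∀ v ∈ A, pos x ≠ f v) (hSA : ∀ v ∈ S, v ∉ A) :
    placeEdges H A pos f lab S φ ∩ placeEdges H A pos f lab S φ' ⊆
      (relEdges H A (S.filter fun v => φ (lab v) = φ' (lab v))).image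
        (Sym2.map (place pos f lab S φ)) := by
  intro e he
  obtain ⟨he1, he2⟩ := Finset.mem_inter.1 he
  obtain ⟨d, hd, rfl⟩ := Finset.mem_image.1 he1
  obtain ⟨d', hd', he'⟩ := Finset.mem_image.1 he2
  obtain ⟨hdH, ⟨u, hud, huS⟩, hdS⟩ := mem_relEdges.1 hd
  obtain ⟨-, -, hdS'⟩ := mem_relEdges.1 hd'
  have key : ∀ x ∈ d, x ∈ S → φ (lab x) = φ' (lab x) := fun x hx hxS => by
    have : place pos f lab S φ x ∈ Sym2.map (place pos f lab S φ') d' := by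
      rw [he']; exact Sym2.mem_map.2 ⟨x, hx, rfl⟩
    obtain ⟨y, hy, hyx⟩ := Sym2.mem_map.1 this
    exact (place_eq_place_of_mem hpos hfree hSA hxS (hdS' y hy) hyx.symm).2.2
  refine Finset.mem_image_of_mem _ (mem_relEdges.2 ⟨hdH, ⟨u, hud, ?_⟩, fun x hx => ?_⟩)
  · exact Finset.mem_filter.2 ⟨huS, key u hud huS⟩
  · rcases hdS x hx with h | h
    · exact Or.inl (Finset.mem_filter.2 ⟨h, key x hx h⟩)
    · exact Or.inr h

/-- A common edge of placements of two sets without common neighbours comes from an edge inside the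
set of vertices that are placed identically. -/
lemma placeEdges_inter_subset_of_far [DecidableEq V] (hpos : Function.Injective pos)
    (hf : Set.InjOn f A)
    (hfree : ∀ x, ∀ v ∈ A, pos x ≠ f v) (hSA : ∀ v ∈ S, v ∉ A) (hSA' : ∀ v ∈ S', v ∉ A)
    (hfar : ∀ u ∈ S, ∀ v ∈ S', ∀ x, H.Adj u x → ¬ H.Adj v x) :
    placeEdges H A pos f lab S φ ∩ placeEdges H A pos f lab' S' φ' ⊆
      (innerEdges H (S.filter fun v => φ (lab v) = φ' (lab v))).image
        (Sym2.map (place pos f lab S φ)) := by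
  intro e he
  obtain ⟨he1, he2⟩ := Finset.mem_inter.1 he
  obtain ⟨d, hd, rfl⟩ := Finset.mem_image.1 he1
  obtain ⟨d', hd', he'⟩ := Finset.mem_image.1 he2
  obtain ⟨hdH, ⟨u, hud, huS⟩, hdS⟩ := mem_relEdges.1 hd
  obtain ⟨hdH', ⟨u', hud', huS'⟩, hdS'⟩ := mem_relEdges.1 hd'
  have key : ∀ x ∈ d, ∃ y ∈ d', place pos f lab S φ x = place pos f lab' S' φ' y := fun x hx => by
    have : place pos f lab S φ x ∈ Sym2.map (place pos f lab' S' φ') d' := by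
      rw [he']; exact Sym2.mem_map.2 ⟨x, hx, rfl⟩
    obtain ⟨y, hy, hyx⟩ := Sym2.mem_map.1 this
    exact ⟨y, hy, hyx.symm⟩
  have adj : ∀ {d : Sym2 V} {a b : V}, d ∈ H.edgeSet → a ∈ d → b ∈ d → a ≠ b → H.Adj a b := by
    intro d a b hd ha hb hab
    rwa [(Sym2.mem_and_mem_iff hab).1 ⟨ha, hb⟩, SimpleGraph.mem_edgeSet] at hd
  refine Finset.mem_image_of_mem _ (mem_innerEdges.2 ⟨hdH, fun x hx => ?_⟩)
  obtain ⟨y, hy, hxy⟩ := key x hx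
  by_cases hxS : x ∈ S
  · exact Finset.mem_filter.2 ⟨hxS,
      (place_eq_place_of_mem hpos hfree hSA' hxS (hdS' y hy) hxy).2.2⟩
  · have hxA := (hdS x hx).resolve_left hxS
    have hxy' := place_eq_place_of_mem_right hf hfree hSA hxA (hdS' y hy) hxy
    subst hxy'
    have h1 := adj hdH hud hx (fun h => hxS (h ▸ huS))
    have h2 := adj hdH' hud' hy (fun h => hSA' _ huS' (h ▸ hxA))
    exact absurd h2 (hfar u huS u' huS' x h1)

end

/-- The number of pairs of maps `Fin s → Fin w` that agree on a given set of `t` elements. -/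
lemma card_agree {s w : ℕ} (U : Finset (Fin s)) :
    ((Finset.univ : Finset ((Fin s → Fin w) × (Fin s → Fin w))).filter
      fun x => ∀ j ∈ U, x.1 j = x.2 j).card = w ^ s * w ^ (s - U.card) := by
  classical
  have h1 : ∀ φ : Fin s → Fin w, ((Finset.univ : Finset (Fin s → Fin w)).filter
      fun φ' => ∀ j ∈ U, φ j = φ' j).card = w ^ (s - U.card) := by
    intro φ
    have : ((Finset.univ : Finset (Fin s → Fin w)).filter fun φ' => ∀ j ∈ U, φ j = φ' j) =
        Fintype.piFinset fun j => if j ∈ U then {φ j} else Finset.univ := by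
      ext φ'
      simp only [Finset.mem_filter, Finset.mem_univ, true_and, Fintype.mem_piFinset]
      refine forall_congr' fun j => ?_
      split_ifs with hj <;> simp [hj, eq_comm]
    rw [this, Fintype.card_piFinset]
    have : ∀ j, (if j ∈ U then {φ j} else (Finset.univ : Finset (Fin w))).card =
        if j ∈ U then 1 else w := fun j => by split_ifs <;> simp
    simp only [this]
    rw [Finset.prod_ite]
    simp only [Finset.prod_const_one, one_mul, Finset.prod_const]
    congr 1
    rw [← Finset.compl_filter, Finset.card_compl]
    simp
  rw [Finset.card_filter, ← Finset.univ_product_univ, Finset.sum_product]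
  simp only [← Finset.card_filter, h1]
  simp

/-- The sum over pairs of placements of the inverse probability of the common edges, over those
pairs that have common edges, when the possible common edges are controlled by the set of vertices
that are placed identically. -/
lemma sum_pairs_le {s w : ℕ} {q L : ℝ} (hq0 : 0 < q) (hq1 : q ≤ 1) (hL : 0 < L) (hw : 0 < w)
    {S : Finset V} (hS : S.card = s) {lab : V → Fin s} (hlab : Set.InjOn lab S)
    (c : (Fin s → Fin w) → (Fin s → Fin w) → ℕ) (e : Finset V → ℕ)
    (hc : ∀ φ φ', ∀ T ⊆ S, (∀ v ∈ S, v ∈ T ↔ φ (lab v) = φ' (lab v)) → c φ φ' ≤ e T)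
    (he : ∀ T ⊆ S, e T ≠ 0 → L * 2 ^ s ≤ (w : ℝ) ^ T.card * q ^ e T) :
    ∑ φ, ∑ φ', (if c φ φ' ≠ 0 then (q ^ c φ φ')⁻¹ else 0) ≤ ((w : ℝ) ^ s) ^ 2 / L := by
  classical
  have hstep : ∀ φ φ' : Fin s → Fin w, (if c φ φ' ≠ 0 then (q ^ c φ φ')⁻¹ else 0) ≤
      ∑ T ∈ S.powerset, (if ∀ j ∈ T.image lab, φ j = φ' j then
        (if e T ≠ 0 then (q ^ e T)⁻¹ else 0) else 0) := by
    intro φ φ'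
    have hnn : ∀ T ∈ S.powerset, (0 : ℝ) ≤ (if ∀ j ∈ T.image lab, φ j = φ' j then
        (if e T ≠ 0 then (q ^ e T)⁻¹ else 0) else 0) := fun T _ => by
      split_ifs <;> positivity
    split_ifs with h0
    · set T := S.filter fun v => φ (lab v) = φ' (lab v) with hT
      have hTS : T ⊆ S := Finset.filter_subset _ _
      have hle := hc φ φ' T hTS fun v hv => by simp [hT, hv]
      refine le_trans ?_ (Finset.single_le_sum hnn (Finset.mem_powerset.2 hTS))
      rw [if_pos, if_pos (by omega)]
      · exact inv_anti₀ (pow_pos hq0 _) (pow_le_pow_of_le_one hq0.le hq1 hle)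
      · intro j hj
        obtain ⟨v, hv, rfl⟩ := Finset.mem_image.1 hj
        exact (Finset.mem_filter.1 hv).2
    · exact Finset.sum_nonneg hnn
  calc ∑ φ, ∑ φ', (if c φ φ' ≠ 0 then (q ^ c φ φ')⁻¹ else 0)
      ≤ ∑ φ : Fin s → Fin w, ∑ φ' : Fin s → Fin w, ∑ T ∈ S.powerset,
          (if ∀ j ∈ T.image lab, φ j = φ' j then
            (if e T ≠ 0 then (q ^ e T)⁻¹ else 0) else 0) :=
        Finset.sum_le_sum fun φ _ => Finset.sum_le_sum fun φ' _ => hstep φ φ'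
    _ = ∑ T ∈ S.powerset, ∑ x : (Fin s → Fin w) × (Fin s → Fin w),
          (if ∀ j ∈ T.image lab, x.1 j = x.2 j then
            (if e T ≠ 0 then (q ^ e T)⁻¹ else 0) else 0) := by
        simp only [Fintype.sum_prod_type]
        rw [Finset.sum_comm (s := S.powerset)]
        exact Finset.sum_congr rfl fun φ _ => Finset.sum_comm
    _ ≤ ∑ T ∈ S.powerset, ((w : ℝ) ^ s) ^ 2 / (L * 2 ^ s) := by
        refine Finset.sum_le_sum fun T hT => ?_
        have hTS := Finset.mem_powerset.1 hT
        rw [← Finset.sum_filter, Finset.sum_const, card_agree,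
          Finset.card_image_of_injOn (hlab.mono hTS), nsmul_eq_mul]
        have hTs : T.card ≤ s := hS ▸ Finset.card_le_card hTS
        have hw' : (0 : ℝ) < w := by exact_mod_cast hw
        split_ifs with h0
        · have h1 := he T hTS h0
          have hsplit : (w : ℝ) ^ s = w ^ (s - T.card) * w ^ T.card := by
            rw [← pow_add, Nat.sub_add_cancel hTs]
          push_cast
          rw [← div_eq_mul_inv, div_le_div_iff₀ (by positivity) (by positivity)]
          have h2 : (w : ℝ) ^ s * w ^ (s - T.card) * (L * 2 ^ s) ≤
              (w : ℝ) ^ s * w ^ (s - T.card) * (w ^ T.card * q ^ e T) :=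
            mul_le_mul_of_nonneg_left h1 (by positivity)
          calc _ ≤ _ := h2
            _ = (w : ℝ) ^ s * (w ^ (s - T.card) * w ^ T.card) * q ^ e T := by ring
            _ = _ := by rw [← hsplit]; ring
        · simp only [mul_zero]
          positivity
    _ = ((w : ℝ) ^ s) ^ 2 / L := by
        rw [Finset.sum_const, Finset.card_powerset, hS, nsmul_eq_mul]
        push_cast
        field_simp

end Placement

section PlacementProb

variable {V : Type*}

lemma exists_injOn_fin {S : Finset V} {s : ℕ} (hS : S.card = s) (hs : 0 < s) :
    ∃ l : V → Fin s, Set.InjOn l S := by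
  classical
  let e := S.equivFinOfCardEq hS
  refine ⟨fun v => if h : v ∈ S then e ⟨v, h⟩ else ⟨0, hs⟩, fun x hx y hy hxy => ?_⟩
  have hx' : x ∈ S := hx
  have hy' : y ∈ S := hy
  simp only [hx', hy', dif_pos] at hxy
  exact congrArg Subtype.val (e.injective hxy)

variable [Fintype V] [DecidableEq V]

/-- The probability that the binomial random graph has no relative copy of a member of `I` inside
the free set `F` is at most `exp (-κ |I| / 2)`, provided that the expected numbers of copies of
their parts are large: Janson's inequality is applied to the placements that send the `j`-th vertex
of each member into the `j`-th of `s` disjoint parts of `F` of size `w`. Each placement is sampled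
with a probability that makes the expected number of sampled copies of each member equal to `κ`. -/
theorem binomialRandom_no_relCopy_le {n s w : ℕ} (H : SimpleGraph V) (A : Set V) (f : V → Fin n)
    (hf : Set.InjOn f A) (q : unitInterval) (hq : 0 < q) (I : Finset (Finset V))
    (F : Finset (Fin n)) (hF : s * w ≤ F.card) (hFA : ∀ v ∈ A, f v ∉ F) (hw : 0 < w) (hs : 0 < s)
    (hI : ∀ S ∈ I, S.card = s) (hIA : ∀ S ∈ I, ∀ v ∈ S, v ∉ A)
    (hfar : ∀ S ∈ I, ∀ S' ∈ I, S ≠ S' → ∀ u ∈ S, ∀ v ∈ S', ∀ x, H.Adj u x → ¬ H.Adj v x)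
    {κ : ℝ} (hκ : 0 < κ) (hne : ∀ S ∈ I, (relEdges H A S).card ≠ 0)
    (hrel : ∀ S ∈ I, ∀ T ⊆ S, (relEdges H A T).card ≠ 0 →
      2 * κ * 2 ^ s ≤ (w : ℝ) ^ T.card * (q : ℝ) ^ (relEdges H A T).card)
    (hinner : ∀ S ∈ I, ∀ T ⊆ S, (innerEdges H T).card ≠ 0 →
      2 * κ * I.card * 2 ^ s ≤ (w : ℝ) ^ T.card * (q : ℝ) ^ (innerEdges H T).card) :
    (SimpleGraph.binomialRandom (Fin n) q).real
      {Γ | ¬ ∃ S ∈ I, ∃ ψ, IsRelCopy H A f Γ S ψ ∧ ∀ v ∈ S, ψ v ∈ F} ≤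
        Real.exp (-(I.card * κ / 2)) := by
  classical
  have hq0 : (0 : ℝ) < q := hq
  have hq1 : (q : ℝ) ≤ 1 := q.2.2
  have hw0 : (0 : ℝ) < w := by exact_mod_cast hw
  obtain ⟨pos₀⟩ : Nonempty (Fin s × Fin w ↪ F) :=
    Function.Embedding.nonempty_of_card_le (by simpa using hF)
  let pos : Fin s × Fin w → Fin n := fun x => (pos₀ x : Fin n)
  have hpos : Function.Injective pos := fun x y h => pos₀.injective (Subtype.ext h)
  have hposF : ∀ x, pos x ∈ F := fun x => (pos₀ x).2
  have hfree : ∀ x, ∀ v ∈ A, pos x ≠ f v := fun x v hv h => hFA v hv (h ▸ hposF x)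
  have hlab' : ∀ S : I, ∃ l : V → Fin s, Set.InjOn l (S : Finset V) := fun S =>
    exists_injOn_fin (hI S S.2) hs
  choose lab hlab using hlab'
  let E : I × (Fin s → Fin w) → Finset (Sym2 (Fin n)) := fun i =>
    placeEdges H A pos f (lab i.1) i.1 i.2
  have hprod : ∀ i, ∀ D ⊆ E i, ∏ e ∈ D, edgeProb (Fin n) q e = (q : ℝ) ^ D.card := by
    intro i D hD
    refine Finset.prod_eq_pow_card fun e he => ?_
    have := not_isDiag_of_mem_placeEdges hpos hf hfree (hIA _ i.1.2) (hlab i.1) (hD he)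
    simp [edgeProb, this]
  have hprodE : ∀ i, ∏ e ∈ E i, edgeProb (Fin n) q e = (q : ℝ) ^ (E i).card := fun i =>
    hprod i _ subset_rfl
  have hprodU : ∀ i j, ∏ e ∈ E i ∪ E j, edgeProb (Fin n) q e =
      (q : ℝ) ^ (E i).card * (q : ℝ) ^ (E j).card * ((q : ℝ) ^ (E i ∩ E j).card)⁻¹ := by
    intro i j
    have h := Finset.prod_union_inter (s₁ := E i) (s₂ := E j) (f := edgeProb (Fin n) q)
    rw [hprodE, hprodE, hprod i _ Finset.inter_subset_left] at h
    rw [← h, mul_assoc, mul_inv_cancel₀ (pow_pos hq0 _).ne', mul_one]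
  let θ : I × (Fin s → Fin w) → ℝ := fun i => κ / (w ^ s * (q : ℝ) ^ (E i).card)
  have hθ : ∀ i, θ i ∈ Set.Icc (0 : ℝ) 1 := by
    intro i
    refine ⟨by positivity, (div_le_one (by positivity)).2 ?_⟩
    have h1 := hrel i.1 i.1.2 i.1 subset_rfl (hne i.1 i.1.2)
    rw [hI _ i.1.2] at h1
    have h2 : (q : ℝ) ^ (relEdges H A (i.1 : Finset V)).card ≤ (q : ℝ) ^ (E i).card :=
      pow_le_pow_of_le_one hq0.le hq1 Finset.card_image_le
    have h3 : (w : ℝ) ^ s * (q : ℝ) ^ (relEdges H A (i.1 : Finset V)).card ≤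
      w ^ s * (q : ℝ) ^ (E i).card := mul_le_mul_of_nonneg_left h2 (by positivity)
    have h4 : (1 : ℝ) ≤ 2 ^ s := one_le_pow₀ (by norm_num)
    nlinarith
  have hsub : {Γ : SimpleGraph (Fin n) |
      ¬ ∃ S ∈ I, ∃ ψ, IsRelCopy H A f Γ S ψ ∧ ∀ v ∈ S, ψ v ∈ F} ⊆
      {Γ | ∀ i, ¬ (E i : Set (Sym2 (Fin n))) ⊆ Γ.edgeSet} := by
    intro Γ hΓ i hi
    refine hΓ ⟨i.1, i.1.2, place pos f (lab i.1) i.1 i.2,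
      isRelCopy_place hpos (hIA _ i.1.2) (hlab i.1) hi, fun v hv => ?_⟩
    rw [place_of_mem hv]
    exact hposF _
  refine (measureReal_mono hsub).trans ((binomialRandom_avoid_le q E).trans
    ((bernExp_avoid_le_exp_weighted (edgeProb_mem q) E θ hθ).trans (Real.exp_le_exp.2 ?_)))
  set N : ℝ := (w : ℝ) ^ s with hN
  have hN0 : 0 < N := by positivity
  have hfirst : ∑ i, θ i * ∏ e ∈ E i, edgeProb (Fin n) q e = I.card * κ := by
    have : ∀ i, θ i * ∏ e ∈ E i, edgeProb (Fin n) q e = κ / N := fun i => by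
      rw [hprodE]
      have : (q : ℝ) ^ (E i).card ≠ 0 := (pow_pos hq0 _).ne'
      simp only [θ, hN]
      field_simp
    simp only [this, Finset.sum_const, Finset.card_univ, Fintype.card_prod, Fintype.card_coe,
      Fintype.card_fun, Fintype.card_fin, nsmul_eq_mul]
    push_cast
    rw [← hN]
    field_simp
  -- the correlation term of two members
  have hpair : ∀ S S' : I, ∑ φ : Fin s → Fin w, ∑ φ' : Fin s → Fin w,
      (if (E (S, φ) ∩ E (S', φ')).card ≠ 0 then ((q : ℝ) ^ (E (S, φ) ∩ E (S', φ')).card)⁻¹ else 0)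
        ≤ N ^ 2 / (if S = S' then 2 * κ else 2 * κ * I.card) := by
    intro S S'
    have hIpos : (0 : ℝ) < I.card := by exact_mod_cast Finset.card_pos.2 ⟨S.1, S.2⟩
    split_ifs with hSS
    · subst hSS
      refine sum_pairs_le hq0 hq1 (by positivity) hw (hI S S.2) (hlab S) _
        (fun T => (relEdges H A T).card) (fun φ φ' T hT hTφ => ?_) (hrel S S.2)
      have : T = (S : Finset V).filter fun v => φ (lab S v) = φ' (lab S v) := by
        ext v
        constructor
        · intro hv; exact Finset.mem_filter.2 ⟨hT hv, (hTφ v (hT hv)).1 hv⟩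
        · intro hv
          obtain ⟨h1, h2⟩ := Finset.mem_filter.1 hv
          exact (hTφ v h1).2 h2
      rw [this]
      exact (Finset.card_le_card (placeEdges_inter_subset hpos hfree (hIA S S.2))).trans
        Finset.card_image_le
    · refine sum_pairs_le hq0 hq1 (by positivity) hw (hI S S.2) (hlab S) _
        (fun T => (innerEdges H T).card) (fun φ φ' T hT hTφ => ?_) (hinner S S.2)
      have : T = (S : Finset V).filter fun v => φ (lab S v) = φ' (lab S v) := by
        ext v
        constructor
        · intro hv; exact Finset.mem_filter.2 ⟨hT hv, (hTφ v (hT hv)).1 hv⟩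
        · intro hv
          obtain ⟨h1, h2⟩ := Finset.mem_filter.1 hv
          exact (hTφ v h1).2 h2
      rw [this]
      exact (Finset.card_le_card (placeEdges_inter_subset_of_far hpos hf hfree (hIA S S.2)
        (hIA S' S'.2) (hfar S S.2 S' S'.2 fun h => hSS (Subtype.ext h)))).trans
        Finset.card_image_le
  have hsecond : ∑ i, ∑ j with i ≠ j ∧ ¬ Disjoint (E i) (E j),
      θ i * θ j * ∏ e ∈ E i ∪ E j, edgeProb (Fin n) q e ≤ I.card * κ := by
    calc ∑ i, ∑ j with i ≠ j ∧ ¬ Disjoint (E i) (E j),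
          θ i * θ j * ∏ e ∈ E i ∪ E j, edgeProb (Fin n) q e
        ≤ ∑ i, ∑ j, (κ / N) ^ 2 * (if (E i ∩ E j).card ≠ 0 then
            ((q : ℝ) ^ (E i ∩ E j).card)⁻¹ else 0) := by
          refine Finset.sum_le_sum fun i _ => ?_
          rw [Finset.sum_filter]
          refine Finset.sum_le_sum fun j _ => ?_
          by_cases hd : Disjoint (E i) (E j)
          · rw [if_neg (by simp [hd])]
            split_ifs <;> positivity
          · have h1 : (E i ∩ E j).card ≠ 0 := by
              rw [Ne, Finset.card_eq_zero, ← Finset.disjoint_iff_inter_eq_empty]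
              exact hd
            rw [if_pos h1]
            split_ifs with h2
            · refine le_of_eq ?_
              rw [hprodU]
              have h3 : (q : ℝ) ^ (E i).card ≠ 0 := (pow_pos hq0 _).ne'
              have h4 : (q : ℝ) ^ (E j).card ≠ 0 := (pow_pos hq0 _).ne'
              have h5 : (q : ℝ) ^ (E i ∩ E j).card ≠ 0 := (pow_pos hq0 _).ne'
              simp only [θ, hN]
              field_simp
            · positivity
      _ = ∑ S : I, ∑ S' : I, (κ / N) ^ 2 * ∑ φ : Fin s → Fin w, ∑ φ' : Fin s → Fin w,
            (if (E (S, φ) ∩ E (S', φ')).card ≠ 0 then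
              ((q : ℝ) ^ (E (S, φ) ∩ E (S', φ')).card)⁻¹ else 0) := by
          simp only [Fintype.sum_prod_type, Finset.mul_sum]
          exact Finset.sum_congr rfl fun S _ => Finset.sum_comm
      _ ≤ ∑ S : I, ∑ S' : I, ((if S = S' then κ / 2 else 0) + κ / (2 * I.card)) := by
          refine Finset.sum_le_sum fun S _ => Finset.sum_le_sum fun S' _ => ?_
          have hIpos : (0 : ℝ) < I.card := by exact_mod_cast Finset.card_pos.2 ⟨S.1, S.2⟩
          refine (mul_le_mul_of_nonneg_left (hpair S S') (by positivity)).trans ?_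
          split_ifs with hSS
          · have : (κ / N) ^ 2 * (N ^ 2 / (2 * κ)) = κ / 2 := by field_simp
            rw [this]
            have : 0 ≤ κ / (2 * I.card) := by positivity
            linarith
          · refine le_of_eq ?_
            field_simp
            ring
      _ = I.card * κ := by
          rcases Finset.eq_empty_or_nonempty I with rfl | hIne
          · simp
          · have hIpos : (0 : ℝ) < I.card := by exact_mod_cast hIne.card_pos
            simp only [Finset.sum_add_distrib, Finset.sum_ite_eq, Finset.mem_univ, if_true,
              Finset.sum_const, Finset.card_univ, Fintype.card_coe, nsmul_eq_mul]
            field_simp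
            ring
  unfold jansonExponent
  rw [hfirst]
  have h2 := hsecond
  have : -((I.card : ℝ) * κ) + (I.card * κ) / 2 = -(I.card * κ / 2) := by ring
  rw [← this]
  gcongr

end PlacementProb

/-! ### Edge counts in minimal dense sets -/

section EdgeCounts

variable {V : Type*}

lemma card_filter_mem_sym2 [DecidableEq V] (T : Finset V) {a b : V} (hab : a ≠ b) :
    (T.filter fun v => v ∈ s(a, b)).card =
      (if a ∈ T then 1 else 0) + (if b ∈ T then 1 else 0) := by
  have : (T.filter fun v => v ∈ s(a, b)) =
      (if a ∈ T then {a} else ∅) ∪ (if b ∈ T then {b} else ∅) := by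
    ext v
    simp only [Finset.mem_filter, Sym2.mem_iff, Finset.mem_union]
    split_ifs <;> simp <;> grind
  rw [this, Finset.card_union_of_disjoint]
  · split_ifs <;> simp
  · split_ifs <;> simp [hab]

variable [Fintype V] {H : SimpleGraph V}

lemma numEdges_eq_card_innerEdges (T : Finset V) : numEdges H T = (innerEdges H T).card := by
  classical
  rw [numEdges, ← Set.ncard_coe_finset (innerEdges H T)]
  refine Set.ncard_congr (fun e _ => Sym2.map Subtype.val e) ?_ ?_ ?_
  · intro e he
    induction e using Sym2.inductionOn with
    | hf u v =>
      refine Finset.mem_coe.2 (mem_innerEdges.2 ⟨he, fun x hx => ?_⟩)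
      rcases Sym2.mem_iff.1 hx with rfl | rfl
      · exact u.2
      · exact v.2
  · intro e e' _ _ h
    exact Sym2.map.injective Subtype.val_injective h
  · intro e he
    obtain ⟨heH, heT⟩ := mem_innerEdges.1 (Finset.mem_coe.1 he)
    induction e using Sym2.inductionOn with
    | hf u v =>
      exact ⟨s(⟨u, heT u (by simp)⟩, ⟨v, heT v (by simp)⟩), heH, rfl⟩

lemma two_mul_card_innerEdges_le_sq (T : Finset V) :
    2 * (innerEdges H T).card ≤ T.card * (T.card - 1) := by
  classical
  have h := (H.induce (T : Set V)).card_edgeFinset_le_card_choose_two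
  have h1 : (H.induce (T : Set V)).edgeFinset.card = (innerEdges H T).card := by
    rw [← numEdges_eq_card_innerEdges, numEdges, ← SimpleGraph.coe_edgeFinset,
      Set.ncard_coe_finset]
  rw [h1] at h
  have h2 : Fintype.card (T : Set V) = T.card := by simp
  rw [h2, Nat.choose_two_right] at h
  exact (Nat.mul_le_mul_left 2 h).trans (Nat.mul_div_le _ _)

lemma sum_degree_eq [DecidableEq V] [DecidableRel H.Adj] (T : Finset V) :
    ∑ v ∈ T, H.degree v = ∑ e ∈ H.edgeFinset, (T.filter fun v => v ∈ e).card := by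
  simp only [← SimpleGraph.card_incidenceFinset_eq_degree, SimpleGraph.incidenceFinset_eq_filter]
  exact Finset.sum_card_bipartiteAbove_eq_sum_card_bipartiteBelow fun v e => v ∈ e

lemma two_mul_card_innerEdges_le_degree [DecidableRel H.Adj] {Δ : ℕ}
    (hΔ : ∀ v, H.degree v ≤ Δ) (T : Finset V) :
    2 * (innerEdges H T).card ≤ T.card * Δ := by
  classical
  calc 2 * (innerEdges H T).card
      = ∑ e ∈ H.edgeFinset, if e ∈ innerEdges H T then 2 else 0 := by
        rw [← Finset.sum_filter, Finset.sum_const, smul_eq_mul, mul_comm]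
        congr 2
        ext e
        simp only [Finset.mem_filter, mem_innerEdges, SimpleGraph.mem_edgeFinset]
        tauto
    _ ≤ ∑ e ∈ H.edgeFinset, (T.filter fun v => v ∈ e).card := by
        refine Finset.sum_le_sum fun e he => ?_
        induction e using Sym2.inductionOn with
        | hf a b =>
          have hab : a ≠ b := H.ne_of_adj (by simpa using he)
          rw [card_filter_mem_sym2 T hab]
          split_ifs with h <;> simp_all [mem_innerEdges]
    _ = ∑ v ∈ T, H.degree v := (sum_degree_eq T).symm
    _ ≤ T.card * Δ := by
        rw [← smul_eq_mul]
        exact Finset.sum_le_card_nsmul _ _ _ fun v _ => hΔ v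

/-- The edges that meet `T ⊆ S` and lie in `T ∪ A`, together with the edges in `S` that meet `T`,
are counted by the sum of the degrees in `T`. -/
lemma card_relEdges_add_le [DecidableEq V] [DecidableRel H.Adj] {Δ : ℕ} {A : Set V}
    (hΔ : ∀ v, H.degree v ≤ Δ) {S T : Finset V} (hT : T ⊆ S) (hSA : ∀ v ∈ S, v ∉ A) :
    (relEdges H A T).card + (innerEdges H S).card ≤
      T.card * Δ + (innerEdges H (S \ T)).card := by
  have hcount : ∀ P : Finset (Sym2 V), P ⊆ H.edgeFinset →
      P.card = ∑ e ∈ H.edgeFinset, if e ∈ P then 1 else 0 := fun P hP => by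
    rw [← Finset.sum_filter, Finset.sum_const, smul_eq_mul, mul_one,
      Finset.filter_mem_eq_inter, Finset.inter_eq_right.2 hP]
  have h1 : relEdges H A T ⊆ H.edgeFinset := fun e he => by simpa using (mem_relEdges.1 he).1
  have h2 : ∀ T, innerEdges H T ⊆ H.edgeFinset := fun T e he => by
    simpa using (mem_innerEdges.1 he).1
  have h3 : ∑ v ∈ T, H.degree v ≤ T.card * Δ := by
    rw [← smul_eq_mul]
    exact Finset.sum_le_card_nsmul _ _ _ fun v _ => hΔ v
  rw [hcount _ h1, hcount _ (h2 S), hcount _ (h2 (S \ T))]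
  refine le_trans ?_ (Nat.add_le_add_right h3 _)
  rw [sum_degree_eq, ← Finset.sum_add_distrib, ← Finset.sum_add_distrib]
  refine Finset.sum_le_sum fun e he => ?_
  induction e using Sym2.inductionOn with
  | hf a b =>
    have hab : a ≠ b := H.ne_of_adj (by simpa using he)
    have heH : H.Adj a b := by simpa using he
    rw [card_filter_mem_sym2 T hab]
    have hr : s(a, b) ∈ relEdges H A T ↔
        (a ∈ T ∨ b ∈ T) ∧ (a ∈ T ∨ a ∈ A) ∧ (b ∈ T ∨ b ∈ A) := by
      simp [mem_relEdges, heH]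
    have hi : ∀ U, s(a, b) ∈ innerEdges H U ↔ a ∈ U ∧ b ∈ U := by
      simp [mem_innerEdges, heH]
    have ha := @hT a
    have hb := @hT b
    have ha' := hSA a
    have hb' := hSA b
    by_cases r : s(a, b) ∈ relEdges H A T <;> by_cases i1 : s(a, b) ∈ innerEdges H S <;>
      by_cases i2 : s(a, b) ∈ innerEdges H (S \ T) <;>
      simp only [r, i1, i2, if_true, if_false] <;> rw [hr] at r <;> rw [hi] at i1 i2 <;>
      rw [Finset.mem_sdiff, Finset.mem_sdiff] at i2 <;>
      clear hcount h1 h2 h3 hr hi he hT hSA hΔ <;> by_cases a1 : a ∈ T <;>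
      by_cases b1 : b ∈ T <;> simp_all

/-- `S` has density larger than `(Δ + 1) / 2` and is minimal with this property, in integral form.
-/
structure IsMinimalDense (H : SimpleGraph V) (Δ : ℕ) (S : Finset V) : Prop where
  three_le : 3 ≤ S.card
  dense : (Δ + 1) * (S.card - 2) < 2 * (innerEdges H S).card
  minimal : ∀ T ⊂ S, 3 ≤ T.card → 2 * (innerEdges H T).card ≤ (Δ + 1) * (T.card - 2)

lemma IsGoodPartition.isMinimalDense [DecidableRel H.Adj] {k : ℕ}
    {𝒮 : Fin k → Finset (Finset V)} {Δ n : ℕ} {α : ℝ} (h : IsGoodPartition H 𝒮 Δ n α)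
    {i : Fin k} {S : Finset V} (hS : S ∈ 𝒮 i) : IsMinimalDense H Δ S where
  three_le := h.three_le i S hS
  dense := by
    have h1 := h.dense i S hS
    have h3 := h.three_le i S hS
    rw [density, numEdges_eq_card_innerEdges] at h1
    obtain ⟨c, hc⟩ := Nat.exists_eq_add_of_le h3
    rw [hc] at h1 ⊢
    push_cast at h1
    rw [div_lt_div_iff₀ (by norm_num) (by linarith [(Nat.cast_nonneg c : (0 : ℝ) ≤ c)])] at h1
    have e : 3 + c - 2 = c + 1 := by omega
    rw [e]
    have : (((Δ + 1) * (c + 1) : ℕ) : ℝ) < ((2 * (innerEdges H S).card : ℕ) : ℝ) := by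
      push_cast
      linarith
    exact_mod_cast this
  minimal T hT h3 := by
    have h1 := h.minimal i S hS T hT h3
    rw [density, numEdges_eq_card_innerEdges] at h1
    obtain ⟨c, hc⟩ := Nat.exists_eq_add_of_le h3
    rw [hc] at h1 ⊢
    push_cast at h1
    rw [div_le_div_iff₀ (by linarith [(Nat.cast_nonneg c : (0 : ℝ) ≤ c)]) (by norm_num)] at h1
    have e : 3 + c - 2 = c + 1 := by omega
    rw [e]
    have : ((2 * (innerEdges H T).card : ℕ) : ℝ) ≤ (((Δ + 1) * (c + 1) : ℕ) : ℝ) := by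
      push_cast
      linarith
    exact_mod_cast this

variable {Δ : ℕ} {S : Finset V}

lemma IsMinimalDense.card_le [DecidableRel H.Adj] (h : IsMinimalDense H Δ S)
    (hΔ : ∀ v, H.degree v ≤ Δ) : S.card ≤ 2 * Δ + 1 := by
  have h1 := h.dense
  have h2 := two_mul_card_innerEdges_le_degree hΔ S
  obtain ⟨c, hc⟩ := Nat.exists_eq_add_of_le h.three_le
  have e : S.card - 2 = c + 1 := by omega
  rw [e] at h1
  rw [hc] at h2 ⊢
  nlinarith

/-- This is where `Δ ≥ 5` is needed. -/
lemma IsMinimalDense.le_card (h : IsMinimalDense H Δ S) (hΔ5 : 5 ≤ Δ) : Δ ≤ S.card := by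
  have h1 := h.dense
  have h2 := two_mul_card_innerEdges_le_sq (H := H) S
  obtain ⟨c, hc⟩ := Nat.exists_eq_add_of_le h.three_le
  have e : S.card - 2 = c + 1 := by omega
  have e' : S.card - 1 = c + 2 := by omega
  rw [e] at h1
  rw [e', hc] at h2
  by_contra! hlt
  obtain ⟨d, hd⟩ := Nat.exists_eq_add_of_lt hlt
  rw [hc] at hd
  subst hd
  rcases Nat.eq_zero_or_pos c with rfl | hc0
  · omega
  · nlinarith

/-- Two copies of `S` that agree on `T` share at most `m = |relEdges H A T|` edges. Since `S \ T` is
sparse and `S` is dense, many edges of `S` meet `T`, which bounds `m` by `card_relEdges_add_le`. -/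
lemma IsMinimalDense.card_relEdges [DecidableEq V] [DecidableRel H.Adj] {A : Set V}
    (h : IsMinimalDense H Δ S) (hΔ5 : 5 ≤ Δ) (hΔ : ∀ v, H.degree v ≤ Δ)
    (hSA : ∀ v ∈ S, v ∉ A) {T : Finset V} (hT : T ⊆ S) (h0 : (relEdges H A T).card ≠ 0) :
    2 * (relEdges H A T).card + 1 ≤ T.card * (Δ + 1) ∨
      T.card = Δ ∧ 2 * (relEdges H A T).card ≤ Δ * (Δ + 1) := by
  have hTne : T.Nonempty := by
    obtain ⟨e, he⟩ := Finset.card_pos.1 (Nat.pos_of_ne_zero h0)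
    obtain ⟨-, ⟨v, -, hv⟩, -⟩ := mem_relEdges.1 he
    exact ⟨v, hv⟩
  have ht := hTne.card_pos
  have hkey := card_relEdges_add_le hΔ hT hSA
  have hd := h.dense
  have hs := h.le_card hΔ5
  have hsub : S \ T ⊂ S := by
    refine Finset.sdiff_ssubset hT hTne
  have hcard : (S \ T).card + T.card = S.card := Finset.card_sdiff_add_card_eq_card hT
  have hsq := two_mul_card_innerEdges_le_sq (H := H) (S \ T)
  have hmin := h.minimal _ hsub
  have h3 := h.three_le
  set m := (relEdges H A T).card
  set e := (innerEdges H S).card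
  set e' := (innerEdges H (S \ T)).card
  set t := T.card
  set u := (S \ T).card
  rw [← hcard] at hd hs h3
  rcases Nat.lt_or_ge u 3 with hu | hu
  · interval_cases hu' : u
    · obtain ⟨c, hc⟩ := Nat.exists_eq_add_of_le (show 2 ≤ t by omega)
      have e1 : 0 + t - 2 = c := by omega
      rw [e1] at hd
      rcases Nat.lt_or_ge t (Δ + 1) with hlt | hge
      · right
        have htΔ : t = Δ := by omega
        refine ⟨htΔ, ?_⟩
        -- the bound `2 * m < Δ * (Δ + 1) + 2` is improved by parity
        obtain ⟨r, hr⟩ := Nat.even_mul_succ_self Δ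
        have hΔc : Δ = 2 + c := by omega
        have : 2 * m < Δ * (Δ + 1) + 2 := by
          rw [htΔ] at hkey
          nlinarith
        omega
      · left
        nlinarith
    · left
      obtain ⟨c, hc⟩ := Nat.exists_eq_add_of_le (show 1 ≤ t by omega)
      have e1 : 1 + t - 2 = c := by omega
      rw [e1] at hd
      have : e' = 0 := by omega
      nlinarith
    · left
      have e1 : 2 + t - 2 = t := by omega
      rw [e1] at hd
      have : e' ≤ 1 := by omega
      nlinarith
  · left
    have hm := hmin hu
    obtain ⟨c, hc⟩ := Nat.exists_eq_add_of_le hu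
    have e1 : u + t - 2 = c + 1 + t := by omega
    have e2 : u - 2 = c + 1 := by omega
    rw [e1] at hd
    rw [e2] at hm
    nlinarith

/-- Copies of two members that agree on `T` share at most `m = |innerEdges H T|` edges; minimality
bounds `m` for proper subsets `T` of `S`, and the degrees do so for `T = S`. -/
lemma IsMinimalDense.card_innerEdges [DecidableRel H.Adj]
    (h : IsMinimalDense H Δ S) (hΔ5 : 5 ≤ Δ) (hΔ : ∀ v, H.degree v ≤ Δ)
    {T : Finset V} (hT : T ⊆ S) (h0 : (innerEdges H T).card ≠ 0) :
    2 ≤ T.card ∧ (2 * (innerEdges H T).card + 1 ≤ (T.card - 1) * (Δ + 1) ∨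
      T.card = Δ + 1 ∧ 2 * (innerEdges H T).card ≤ Δ * (Δ + 1)) := by
  have hsq := two_mul_card_innerEdges_le_sq (H := H) T
  have hdeg := two_mul_card_innerEdges_le_degree hΔ T
  have hs := h.le_card hΔ5
  have h2 : 2 ≤ T.card := by
    by_contra! hlt
    interval_cases hc : T.card <;> omega
  refine ⟨h2, ?_⟩
  by_cases hTS : T = S
  · subst hTS
    obtain ⟨c, hc⟩ := Nat.exists_eq_add_of_le h2
    have e1 : T.card - 1 = c + 1 := by omega
    rw [e1] at hsq ⊢
    rcases Nat.lt_trichotomy T.card (Δ + 1) with hlt | heq | hgt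
    · left
      have : Δ = 2 + c := by omega
      rw [hc] at hsq
      subst this
      nlinarith
    · right
      refine ⟨heq, ?_⟩
      rw [heq] at hdeg
      linarith
    · left
      rw [hc] at hdeg
      nlinarith
  · left
    have hss : T ⊂ S := lt_of_le_of_ne hT hTS
    rcases Nat.lt_or_ge T.card 3 with hlt | hge
    · have : T.card = 2 := by omega
      rw [this] at hsq ⊢
      omega
    · have hm := h.minimal T hss hge
      obtain ⟨c, hc⟩ := Nat.exists_eq_add_of_le hge
      have e1 : T.card - 1 = c + 2 := by omega
      have e2 : T.card - 2 = c + 1 := by omega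
      rw [e2] at hm
      rw [e1]
      nlinarith

end EdgeCounts

/-! ### The edge probability is above the threshold -/

section Threshold

lemma le_mul_of_one_sub_pow {k : ℕ} {q P : ℝ} (hq1 : q ≤ 1)
    (h : (1 - q) ^ (k + 1) = 1 - P) : P ≤ (k + 1) * q := by
  have := one_add_mul_le_pow (a := -q) (by linarith) (k + 1)
  rw [← sub_eq_add_neg, h] at this
  push_cast at this
  linarith

/-- In the range `p ≫ (n⁻¹ (log n)^(1/Δ))^(2/(Δ+1))`, the quantities `w ^ t * q ^ m` that control
the second moment are much larger than `log n`: for `2 m < t (Δ + 1)` they grow polynomially, and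
for `t = Δ`, `m = Δ (Δ + 1) / 2` this is the definition of the threshold. -/
theorem eventually_le_pow_mul_pow {Δ : ℕ} (hΔ : 1 ≤ Δ) (K : ℕ) {p : ℕ → ℝ}
    (hp : (fun n : ℕ => ((n : ℝ)⁻¹ * Real.log n ^ (1 / (Δ : ℝ))) ^ (2 / ((Δ : ℝ) + 1)))
      =o[atTop] p) {c C : ℝ} (hc : 0 < c) (hc1 : c ≤ 1) (hC : 0 < C) :
    ∀ᶠ n : ℕ in atTop, ∀ k ≤ K, ∀ q : ℝ, 0 < q → q < 1 → (1 - q) ^ (k + 1) = 1 - p n →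
      ∀ w : ℕ, c * n ≤ w →
        (∀ t m : ℕ, t ≤ 2 * Δ + 1 → 2 * m + 1 ≤ t * (Δ + 1) →
          C * Real.log n ≤ (w : ℝ) ^ t * q ^ m) ∧
        (∀ m : ℕ, 2 * m ≤ Δ * (Δ + 1) → C * Real.log n ≤ (w : ℝ) ^ Δ * q ^ m) := by
  set B : ℝ := max 1 (C / c ^ Δ) with hB
  have hB1 : 1 ≤ B := le_max_left _ _
  have hB0 : 0 < B := by linarith
  have hBC : C ≤ c ^ Δ * B := by
    have : C / c ^ Δ ≤ B := le_max_right _ _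
    rwa [div_le_iff₀ (by positivity), mul_comm] at this
  have hΔ0 : (0 : ℝ) < Δ := by exact_mod_cast hΔ
  have hlog : ∀ᶠ n : ℕ in atTop,
      C * Real.log n ≤ c ^ (2 * Δ + 1) * (n : ℝ) ^ (1 / ((Δ : ℝ) + 1)) := by
    have h1 := (isLittleO_log_rpow_atTop (r := 1 / ((Δ : ℝ) + 1)) (by positivity)).bound
      (c := c ^ (2 * Δ + 1) / C) (by positivity)
    have h2 := tendsto_natCast_atTop_atTop (R := ℝ) |>.eventually h1
    filter_upwards [h2, eventually_ge_atTop 1] with n hn hn1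
    have hn0 : (1 : ℝ) ≤ n := by exact_mod_cast hn1
    rw [Real.norm_of_nonneg (Real.log_nonneg hn0), Real.norm_of_nonneg (by positivity),
      div_mul_eq_mul_div, le_div_iff₀ hC] at hn
    linarith
  filter_upwards [hlog, hp.bound (c := 1 / (B * (K + 1))) (by positivity),
    eventually_ge_atTop 3] with n hn hpn hn3 k hk q hq0 hq1 hqp w hw
  have hn3' : (3 : ℝ) ≤ n := by exact_mod_cast hn3
  have hn0 : (0 : ℝ) < n := by linarith
  have hlog1 : 1 ≤ Real.log n := by
    rw [Real.le_log_iff_exp_le hn0]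
    have := Real.exp_one_lt_d9
    linarith
  set z : ℝ := (n : ℝ)⁻¹ * Real.log n ^ (1 / (Δ : ℝ)) with hz
  have hz0 : 0 < z := by positivity
  have hzn : (n : ℝ)⁻¹ ≤ z := by
    have : 1 ≤ Real.log n ^ (1 / (Δ : ℝ)) := Real.one_le_rpow hlog1 (by positivity)
    exact le_mul_of_one_le_right (by positivity) this
  set x : ℝ := z ^ (2 / ((Δ : ℝ) + 1)) with hx
  have hx0 : 0 < x := by positivity
  -- passing from `p` to `q` costs a constant factor
  have hqx : B * x ≤ q := by
    have h1 := le_mul_of_one_sub_pow hq1.le hqp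
    have h2 : 0 < p n := by
      have : (1 - q) ^ (k + 1) < 1 := pow_lt_one₀ (by linarith) (by linarith) (by omega)
      linarith
    rw [Real.norm_of_nonneg hx0.le, Real.norm_of_nonneg h2.le, one_div_mul_eq_div,
      le_div_iff₀ (by positivity)] at hpn
    have h3 : ((k : ℝ) + 1) * q ≤ (K + 1) * q := by
      have : (k : ℝ) ≤ K := by exact_mod_cast hk
      nlinarith
    have h4 : (B * x) * (K + 1) ≤ q * (K + 1) := by nlinarith
    exact le_of_mul_le_mul_right h4 (by positivity)
  have hxq : x ≤ q := le_trans (le_mul_of_one_le_left hx0.le hB1) hqx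
  have hcn : 0 ≤ c * (n : ℝ) := by positivity
  constructor
  · intro t m ht hm
    have h1 : ((n : ℝ) ^ (-(2 * m / ((Δ : ℝ) + 1)))) ≤ q ^ m := by
      have h2 : (n : ℝ)⁻¹ ^ (2 / ((Δ : ℝ) + 1)) ≤ q :=
        (Real.rpow_le_rpow (by positivity) hzn (by positivity)).trans hxq
      calc ((n : ℝ) ^ (-(2 * m / ((Δ : ℝ) + 1)))) = ((n : ℝ)⁻¹ ^ (2 / ((Δ : ℝ) + 1))) ^ m := by
            rw [← Real.rpow_mul_natCast (by positivity), Real.inv_rpow hn0.le,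
              Real.rpow_neg hn0.le]
            congr 2
            ring
        _ ≤ q ^ m := pow_le_pow_left₀ (by positivity) h2 m
    have h3 : c ^ (2 * Δ + 1) * (n : ℝ) ^ (t : ℝ) ≤ (w : ℝ) ^ t := by
      calc c ^ (2 * Δ + 1) * (n : ℝ) ^ (t : ℝ) ≤ c ^ t * (n : ℝ) ^ t := by
            rw [Real.rpow_natCast]
            exact mul_le_mul_of_nonneg_right (pow_le_pow_of_le_one hc.le hc1 ht) (by positivity)
        _ = (c * n) ^ t := (mul_pow _ _ _).symm
        _ ≤ _ := pow_le_pow_left₀ hcn hw t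
    calc C * Real.log n ≤ c ^ (2 * Δ + 1) * (n : ℝ) ^ (1 / ((Δ : ℝ) + 1)) := hn
      _ ≤ c ^ (2 * Δ + 1) * (n : ℝ) ^ ((t : ℝ) + -(2 * m / ((Δ : ℝ) + 1))) := by
          refine mul_le_mul_of_nonneg_left (Real.rpow_le_rpow_of_exponent_le (by linarith) ?_)
            (by positivity)
          have h5 : (2 * (m : ℝ) + 1) ≤ t * (Δ + 1) := by exact_mod_cast hm
          rw [← sub_eq_add_neg, le_sub_iff_add_le, ← add_div, div_le_iff₀ (by positivity)]
          linarith
      _ = (c ^ (2 * Δ + 1) * (n : ℝ) ^ (t : ℝ)) * (n : ℝ) ^ (-(2 * m / ((Δ : ℝ) + 1))) := by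
          rw [Real.rpow_add hn0, mul_assoc]
      _ ≤ (w : ℝ) ^ t * q ^ m := mul_le_mul h3 h1 (by positivity) (by positivity)
  · intro m hm
    obtain ⟨M, hM⟩ := Nat.even_mul_succ_self Δ
    have hM1 : M ≠ 0 := by
      rintro rfl
      have : 0 < Δ * (Δ + 1) := by positivity
      omega
    have hmM : m ≤ M := by omega
    have hMr : (Δ : ℝ) * (Δ + 1) = 2 * M := by
      have : ((Δ * Nat.succ Δ : ℕ) : ℝ) = ((M + M : ℕ) : ℝ) := by rw [hM]
      push_cast at this
      linarith
    have hxM : x ^ M = ((n : ℝ) ^ Δ)⁻¹ * Real.log n := by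
      rw [hx, ← Real.rpow_mul_natCast hz0.le]
      have : 2 / ((Δ : ℝ) + 1) * M = Δ := by
        field_simp
        linarith
      rw [this, Real.rpow_natCast, hz, mul_pow, inv_pow, ← Real.rpow_mul_natCast (by linarith),
        one_div_mul_cancel hΔ0.ne', Real.rpow_one]
    calc C * Real.log n ≤ (c ^ Δ * B) * Real.log n :=
          mul_le_mul_of_nonneg_right hBC (by linarith)
      _ = (c * n) ^ Δ * (B * x ^ M) := by
          rw [hxM, mul_pow]
          field_simp
      _ ≤ (w : ℝ) ^ Δ * q ^ m := by
          refine mul_le_mul (pow_le_pow_left₀ hcn hw Δ) ?_ (by positivity) (by positivity)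
          calc B * x ^ M ≤ B ^ M * x ^ M :=
                mul_le_mul_of_nonneg_right (le_self_pow₀ hB1 hM1) (by positivity)
            _ = (B * x) ^ M := (mul_pow _ _ _).symm
            _ ≤ q ^ M := pow_le_pow_left₀ (by positivity) hqx M
            _ ≤ q ^ m := pow_le_pow_of_le_one hq0.le hq1.le hmM

end Threshold

/-! ### Embedding one batch -/

section UnionBound

variable {V : Type*} [Fintype V] [DecidableEq V]

/-- Haxell's condition, for relative copies of the members of a batch `𝓢` inside a free set `F`. -/
def HallCondition {n : ℕ} (H : SimpleGraph V) (A : Set V) (f : V → Fin n) (F : Finset (Fin n))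
    (s : ℕ) (𝓢 : Finset (Finset V)) (Γ : SimpleGraph (Fin n)) : Prop :=
  ∀ I ⊆ 𝓢, I.Nonempty → ∀ X : Finset (Fin n), X.card ≤ 2 * s * (I.card - 1) →
    ∃ S ∈ I, ∃ ψ, IsRelCopy H A f Γ S ψ ∧ ∀ v ∈ S, ψ v ∈ F \ X

/-- The union bound over the subfamilies `I` and the excluded sets `X`: there are at most
`n ^ ((2 * s + 1) * r)` pairs with `|I| = r`, and each fails with probability at most
`n ^ (-(2 * s + 3) * r)`. -/
theorem binomialRandom_not_hallCondition_le {n s w : ℕ} (hn : 1 ≤ n) (H : SimpleGraph V)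
    (A : Set V) (f : V → Fin n) (hf : Set.InjOn f A) (q : unitInterval) (hq : 0 < q)
    (𝓢 : Finset (Finset V)) (F : Finset (Fin n)) (hF : s * w + 2 * s * 𝓢.card ≤ F.card)
    (h𝓢n : 𝓢.card ≤ n) (hFA : ∀ v ∈ A, f v ∉ F) (hw : 0 < w) (hs : 0 < s)
    (h𝓢 : ∀ S ∈ 𝓢, S.card = s) (h𝓢A : ∀ S ∈ 𝓢, ∀ v ∈ S, v ∉ A)
    (hfar : ∀ S ∈ 𝓢, ∀ S' ∈ 𝓢, S ≠ S' → ∀ u ∈ S, ∀ v ∈ S', ∀ x, H.Adj u x → ¬ H.Adj v x)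
    {κ : ℝ} (hκ0 : 0 < κ) (hκ : κ = 2 * (2 * s + 3) * Real.log n)
    (hne : ∀ S ∈ 𝓢, (relEdges H A S).card ≠ 0)
    (hrel : ∀ S ∈ 𝓢, ∀ T ⊆ S, (relEdges H A T).card ≠ 0 →
      2 * κ * 2 ^ s ≤ (w : ℝ) ^ T.card * (q : ℝ) ^ (relEdges H A T).card)
    (hinner : ∀ S ∈ 𝓢, ∀ T ⊆ S, (innerEdges H T).card ≠ 0 →
      2 * κ * n * 2 ^ s ≤ (w : ℝ) ^ T.card * (q : ℝ) ^ (innerEdges H T).card) :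
    (SimpleGraph.binomialRandom (Fin n) q).real {Γ | ¬ HallCondition H A f F s 𝓢 Γ} ≤
      1 / n := by
  classical
  have hn0 : (0 : ℝ) < n := by exact_mod_cast hn
  have hn1 : (1 : ℝ) ≤ n := by exact_mod_cast hn
  let bad : Finset (Finset V) → Finset (Fin n) → Set (SimpleGraph (Fin n)) := fun I X =>
    {Γ | ¬ ∃ S ∈ I, ∃ ψ, IsRelCopy H A f Γ S ψ ∧ ∀ v ∈ S, ψ v ∈ F \ X}
  let xs : ∀ r : ℕ, Finset (Fin (2 * s * r) → Fin n) := fun r => Finset.univ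
  have hsub : {Γ | ¬ HallCondition H A f F s 𝓢 Γ} ⊆
      ⋃ r ∈ Finset.Icc 1 n, ⋃ I ∈ 𝓢.powersetCard r, ⋃ x ∈ xs r,
        bad I (Finset.univ.image x) := by
    intro Γ hΓ
    have hΓ' : ¬ HallCondition H A f F s 𝓢 Γ := hΓ
    unfold HallCondition at hΓ'
    push Not at hΓ'
    obtain ⟨I, hI, hIne, X, hX, hno⟩ := hΓ'
    have hpos : 0 < 2 * s * I.card := by have := hIne.card_pos; positivity
    -- a set with at most `2 * s * |I|` elements is covered by the range of a function
    obtain ⟨x, hx⟩ : ∃ x : Fin (2 * s * I.card) → Fin n, X ⊆ Finset.univ.image x := by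
      have hle : X.card ≤ 2 * s * I.card := hX.trans (Nat.mul_le_mul_left _ (Nat.sub_le _ _))
      let e := X.equivFin
      refine ⟨fun j => if h : (j : ℕ) < X.card then e.symm ⟨j, h⟩ else ⟨0, hn⟩, fun v hv => ?_⟩
      refine Finset.mem_image.2 ⟨⟨e ⟨v, hv⟩, (e ⟨v, hv⟩).2.trans_le hle⟩, Finset.mem_univ _, ?_⟩
      simp
    simp only [Set.mem_iUnion]
    refine ⟨I.card, Finset.mem_Icc.2 ⟨hIne.card_pos, (Finset.card_le_card hI).trans h𝓢n⟩, I,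
      Finset.mem_powersetCard.2 ⟨hI, rfl⟩, x, Finset.mem_univ _, ?_⟩
    rintro ⟨S, hS, ψ, hψ, hψF⟩
    obtain ⟨v, hv, hv'⟩ := hno S hS ψ hψ
    exact hv' (Finset.sdiff_subset_sdiff subset_rfl hx (hψF v hv))
  have hbad : ∀ r, ∀ I ∈ 𝓢.powersetCard r, ∀ x : Fin (2 * s * r) → Fin n,
      (SimpleGraph.binomialRandom (Fin n) q).real (bad I (Finset.univ.image x)) ≤
        ((n : ℝ) ^ ((2 * s + 3) * r))⁻¹ := by
    intro r I hI x
    obtain ⟨hI𝓢, hIr⟩ := Finset.mem_powersetCard.1 hI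
    have hr𝓢 : r ≤ 𝓢.card := hIr ▸ Finset.card_le_card hI𝓢
    have hFX : s * w ≤ (F \ Finset.univ.image x).card := by
      have h1 := Finset.le_card_sdiff (Finset.univ.image x) F
      have h2 : (Finset.univ.image x).card ≤ 2 * s * r := by
        simpa using (Finset.card_image_le (s := Finset.univ) (f := x))
      have h3 : 2 * s * r ≤ 2 * s * 𝓢.card := Nat.mul_le_mul_left _ hr𝓢
      omega
    have h := binomialRandom_no_relCopy_le H A f hf q hq I (F \ Finset.univ.image x) hFX
      (fun v hv hv' => hFA v hv (Finset.mem_sdiff.1 hv').1) hw hs (fun S hS => h𝓢 S (hI𝓢 hS))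
      (fun S hS => h𝓢A S (hI𝓢 hS)) (fun S hS S' hS' => hfar S (hI𝓢 hS) S' (hI𝓢 hS')) hκ0
      (fun S hS => hne S (hI𝓢 hS)) (fun S hS => hrel S (hI𝓢 hS))
      (fun S hS T hT h0 => by
        refine le_trans ?_ (hinner S (hI𝓢 hS) T hT h0)
        have : (I.card : ℝ) ≤ n := by exact_mod_cast (hIr ▸ hr𝓢.trans h𝓢n)
        gcongr)
    refine h.trans (le_of_eq ?_)
    have e : -((I.card : ℝ) * κ / 2) = -((((2 * s + 3) * r : ℕ) : ℝ) * Real.log n) := by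
      rw [hκ, hIr]
      push_cast
      ring
    rw [e, Real.exp_neg, ← Real.rpow_natCast, Real.rpow_def_of_pos hn0, mul_comm]
  refine (measureReal_mono hsub (measure_ne_top _ _)).trans
    ((measureReal_biUnion_finset_le _ _).trans ?_)
  calc ∑ r ∈ Finset.Icc 1 n, (SimpleGraph.binomialRandom (Fin n) q).real
        (⋃ I ∈ 𝓢.powersetCard r, ⋃ x ∈ xs r, bad I (Finset.univ.image x))
      ≤ ∑ r ∈ Finset.Icc 1 n, ((n : ℝ) ^ 2)⁻¹ := by
        refine Finset.sum_le_sum fun r hr => (measureReal_biUnion_finset_le _ _).trans ?_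
        calc ∑ I ∈ 𝓢.powersetCard r, (SimpleGraph.binomialRandom (Fin n) q).real
              (⋃ x ∈ xs r, bad I (Finset.univ.image x))
            ≤ ∑ I ∈ 𝓢.powersetCard r, ∑ x ∈ xs r, ((n : ℝ) ^ ((2 * s + 3) * r))⁻¹ :=
              Finset.sum_le_sum fun I hI => (measureReal_biUnion_finset_le _ _).trans
                (Finset.sum_le_sum fun x _ => hbad r I hI x)
          _ = ((𝓢.card.choose r : ℕ) : ℝ) * ((n : ℝ) ^ (2 * s * r) *
                ((n : ℝ) ^ ((2 * s + 3) * r))⁻¹) := by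
              simp [xs, Finset.card_powersetCard]
          _ ≤ (n : ℝ) ^ r * ((n : ℝ) ^ (2 * s * r) * ((n : ℝ) ^ ((2 * s + 3) * r))⁻¹) := by
              refine mul_le_mul_of_nonneg_right ?_ (by positivity)
              have : 𝓢.card.choose r ≤ n ^ r :=
                (Nat.choose_le_pow _ _).trans (Nat.pow_le_pow_left h𝓢n r)
              exact_mod_cast this
          _ = ((n : ℝ) ^ (2 * r))⁻¹ := by
              have : (2 * s + 3) * r = r + 2 * s * r + 2 * r := by ring
              rw [this, pow_add, pow_add]
              field_simp
          _ ≤ ((n : ℝ) ^ 2)⁻¹ := by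
              have h1 := (Finset.mem_Icc.1 hr).1
              exact inv_anti₀ (by positivity) (pow_le_pow_right₀ hn1 (by omega))
    _ = 1 / n := by
        rw [Finset.sum_const, Nat.card_Icc, nsmul_eq_mul]
        push_cast [Nat.add_sub_cancel]
        field_simp

end UnionBound

section Extension

variable {m n k : ℕ} {H : SimpleGraph (Fin m)} [DecidableRel H.Adj]
  {𝒮 : Fin k → Finset (Finset (Fin m))} {Δ : ℕ} {α : ℝ}

lemma IsGoodPartition.notMem_stageVerts (hgood : IsGoodPartition H 𝒮 Δ n α) (h : Fin k)
    {S : Finset (Fin m)} (hS : S ∈ 𝒮 h) {v : Fin m} (hv : v ∈ S) : v ∉ stageVerts 𝒮 (h : ℕ) := by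
  rintro (hv' | ⟨i, hi, S', hS', hv'⟩)
  · exact hv' h S hS hv
  · have hne : i ≠ h := by rintro rfl; exact lt_irrefl _ hi
    exact Finset.disjoint_left.1 (hgood.disjoint i h S' hS' S hS (Or.inl hne)) hv' hv

lemma IsGoodPartition.not_adj (hgood : IsGoodPartition H 𝒮 Δ n α) {h : Fin k}
    {S S' : Finset (Fin m)} (hS : S ∈ 𝒮 h) (hS' : S' ∈ 𝒮 h) (hne : S ≠ S') {u v : Fin m}
    (hu : u ∈ S) (hv : v ∈ S') : ¬ H.Adj u v := by
  intro huv
  have h1 := hgood.far h S hS S' hS' hne u hu v hv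
  have h2 := h1.trans (SimpleGraph.Walk.edist_le huv.toWalk)
  norm_num at h2

lemma IsGoodPartition.not_adj_of_adj (hgood : IsGoodPartition H 𝒮 Δ n α) {h : Fin k}
    {S S' : Finset (Fin m)} (hS : S ∈ 𝒮 h) (hS' : S' ∈ 𝒮 h) (hne : S ≠ S') {u v x : Fin m}
    (hu : u ∈ S) (hv : v ∈ S') (hux : H.Adj u x) : ¬ H.Adj v x := by
  intro hvx
  have h1 := hgood.far h S hS S' hS' hne u hu v hv
  have h2 := h1.trans (SimpleGraph.Walk.edist_le (.cons hux (.cons hvx.symm .nil)))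
  simp only [SimpleGraph.Walk.length_cons, SimpleGraph.Walk.length_nil] at h2
  norm_num at h2

lemma mem_stageVerts_succ {h : Fin k} {v : Fin m} (hv : v ∈ stageVerts 𝒮 ((h : ℕ) + 1)) :
    v ∈ stageVerts 𝒮 (h : ℕ) ∨ ∃ S ∈ 𝒮 h, v ∈ S := by
  rcases hv with hv | ⟨i, hi, S, hS, hv⟩
  · exact Or.inl (Or.inl hv)
  · rcases Nat.lt_succ_iff_lt_or_eq.1 hi with hi | hi
    · exact Or.inl (Or.inr ⟨i, hi, S, hS, hv⟩)
    · have : i = h := Fin.ext hi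
      subst this
      exact Or.inr ⟨S, hS, hv⟩

/-- If Haxell's condition holds in `G_{h+1}`, then the embedding extends to the next batch. -/
theorem extends_of_hallCondition (hgood : IsGoodPartition H 𝒮 Δ n α) (h : Fin k)
    (g : Fin (k + 1) → SimpleGraph (Fin n))
    (f : SimpleGraph.Copy (stage H 𝒮 (h : ℕ)) (unionUpTo g h.castSucc)) (f₀ : Fin m → Fin n)
    (hf₀ : ∀ v (hv : v ∈ stageVerts 𝒮 (h : ℕ)), f₀ v = f ⟨v, hv⟩) {s : ℕ}
    (hs : ∀ S ∈ 𝒮 h, S.card = s) (F : Finset (Fin n))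
    (hFA : ∀ v ∈ stageVerts 𝒮 (h : ℕ), f₀ v ∉ F) (G : Fin (k + 1) → SimpleGraph (Fin n))
    (hG : ∀ i ≤ h.castSucc, G i = g i)
    (hall : HallCondition H (stageVerts 𝒮 (h : ℕ)) f₀ F s (𝒮 h) (G h.succ)) :
    Extends H 𝒮 h f G := by
  classical
  set A := stageVerts 𝒮 (h : ℕ) with hA
  have hSA : ∀ S ∈ 𝒮 h, ∀ v ∈ S, v ∉ A := fun S hS v hv => hgood.notMem_stageVerts h hS hv
  let 𝓕 : Finset (Fin m) → Set (Finset (Fin n)) := fun S =>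
    {D | S.card ≤ s ∧ ∃ ψ, IsRelCopy H A f₀ (G h.succ) S ψ ∧ (∀ v ∈ S, ψ v ∈ F) ∧ D = S.image ψ}
  obtain ⟨M, hM𝓕, hMd⟩ := exists_isPartialRep (𝓕 := 𝓕) (s := s) (𝒮 h)
    (fun S D hD => by
      obtain ⟨hSs, ψ, -, -, rfl⟩ := hD
      exact Finset.card_image_le.trans hSs)
    (fun I hI hIne X hX => by
      obtain ⟨S, hS, ψ, hψ, hψF⟩ := hall I hI hIne X hX
      refine ⟨S, hS, S.image ψ, ⟨(hs S (hI hS)).le, ψ, hψ,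
        fun v hv => (Finset.mem_sdiff.1 (hψF v hv)).1, rfl⟩, ?_⟩
      rw [Finset.disjoint_left]
      intro y hy
      obtain ⟨v, hv, rfl⟩ := Finset.mem_image.1 hy
      exact (Finset.mem_sdiff.1 (hψF v hv)).2)
  have hψ' : ∀ S : 𝒮 h, ∃ ψ, IsRelCopy H A f₀ (G h.succ) S ψ ∧
      (∀ v ∈ (S : Finset (Fin m)), ψ v ∈ F) ∧ M S = (S : Finset (Fin m)).image ψ := fun S =>
    (hM𝓕 S S.2).2
  choose ψ hψ hψF hψM using hψ'
  let Ψ : Fin m → Fin n := fun v =>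
    if hv : ∃ S : 𝒮 h, v ∈ (S : Finset (Fin m)) then ψ hv.choose v else f₀ v
  have hΨA : ∀ v ∈ A, Ψ v = f₀ v := fun v hv => dif_neg fun ⟨S, hS⟩ => hSA S S.2 v hS hv
  have hΨS : ∀ S : 𝒮 h, ∀ v ∈ (S : Finset (Fin m)), Ψ v = ψ S v := fun S v hv => by
    have hex : ∃ S : 𝒮 h, v ∈ (S : Finset (Fin m)) := ⟨S, hv⟩
    have heq : hex.choose = S := by
      by_contra hne
      exact Finset.disjoint_left.1 (hgood.disjoint h h _ hex.choose.2 _ S.2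
        (Or.inr fun h' => hne (Subtype.ext h'))) hex.choose_spec hv
    have : Ψ v = ψ hex.choose v := dif_pos hex
    rw [this, heq]
  have hΨadj : ∀ S : 𝒮 h, ∀ u ∈ (S : Finset (Fin m)), ∀ v ∈ stageVerts 𝒮 ((h : ℕ) + 1),
      H.Adj u v → (G h.succ).Adj (Ψ u) (Ψ v) := by
    intro S u hu v hv huv
    rcases mem_stageVerts_succ hv with hvA | ⟨S', hS', hvS'⟩
    · rw [hΨS S u hu, hΨA v hvA, ← (hψ S).eq_of_mem v hvA]
      exact (hψ S).map_adj u hu v (Or.inr hvA) huv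
    · have : (S : Finset (Fin m)) = S' := by
        by_contra hne
        exact hgood.not_adj S.2 hS' hne hu hvS' huv
      subst this
      rw [hΨS S u hu, hΨS S v hvS']
      exact (hψ S).map_adj u hu v (Or.inl hvS') huv
  have hΨnew : ∀ u ∈ stageVerts 𝒮 ((h : ℕ) + 1), ∀ v ∈ stageVerts 𝒮 ((h : ℕ) + 1),
      H.Adj u v → ¬ (u ∈ A ∧ v ∈ A) → (G h.succ).Adj (Ψ u) (Ψ v) := by
    intro u hu v hv huv hnot
    rcases mem_stageVerts_succ hu with huA | ⟨S, hS, huS⟩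
    · rcases mem_stageVerts_succ hv with hvA | ⟨S, hS, hvS⟩
      · exact absurd ⟨huA, hvA⟩ hnot
      · exact (hΨadj ⟨S, hS⟩ v hvS u hu huv.symm).symm
    · exact hΨadj ⟨S, hS⟩ u huS v hv huv
  have hΨF : ∀ S : 𝒮 h, ∀ v ∈ (S : Finset (Fin m)), Ψ v ∈ F := fun S v hv => by
    rw [hΨS S v hv]; exact hψF S v hv
  have hfinj : ∀ u ∈ A, ∀ v ∈ A, f₀ u = f₀ v → u = v := fun u hu v hv huv => by
    rw [hf₀ u hu, hf₀ v hv] at huv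
    exact congrArg Subtype.val (f.injective huv)
  have hΨinj : ∀ u ∈ stageVerts 𝒮 ((h : ℕ) + 1), ∀ v ∈ stageVerts 𝒮 ((h : ℕ) + 1),
      Ψ u = Ψ v → u = v := by
    intro u hu v hv huv
    rcases mem_stageVerts_succ hu with huA | ⟨S, hS, huS⟩ <;>
      rcases mem_stageVerts_succ hv with hvA | ⟨S', hS', hvS⟩
    · rw [hΨA u huA, hΨA v hvA] at huv
      exact hfinj u huA v hvA huv
    · rw [hΨA u huA] at huv
      exact absurd (huv ▸ hΨF ⟨S', hS'⟩ v hvS) (hFA u huA)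
    · rw [hΨA v hvA] at huv
      exact absurd (huv ▸ hΨF ⟨S, hS⟩ u huS) (hFA v hvA)
    · rw [hΨS ⟨S, hS⟩ u huS, hΨS ⟨S', hS'⟩ v hvS] at huv
      have heq : S = S' := by
        by_contra hne
        have hd := hMd S hS S' hS' hne
        rw [hψM ⟨S, hS⟩, hψM ⟨S', hS'⟩] at hd
        exact Finset.disjoint_left.1 hd (Finset.mem_image_of_mem _ huS)
          (huv ▸ Finset.mem_image_of_mem _ hvS)
      subst heq
      exact (hψ ⟨S, hS⟩).injOn huS hvS huv
  have hle : unionUpTo g h.castSucc ≤ unionUpTo G h.succ := by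
    refine iSup₂_le fun i hi => ?_
    rw [← hG i hi]
    exact le_iSup₂_of_le i (hi.trans (Fin.castSucc_lt_succ).le) le_rfl
  have hle' : G h.succ ≤ unionUpTo G h.succ := le_iSup₂_of_le h.succ le_rfl le_rfl
  refine ⟨⟨⟨fun v => Ψ v, fun {u v} huv => ?_⟩, fun u v huv =>
    Subtype.ext (hΨinj u u.2 v v.2 huv)⟩, fun v hv _ => ?_, fun u v huv hnot => ?_⟩
  · by_cases hA' : (u : Fin m) ∈ A ∧ (v : Fin m) ∈ A
    · rw [hΨA _ hA'.1, hΨA _ hA'.2, hf₀ _ hA'.1, hf₀ _ hA'.2]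
      refine hle (f.toHom.map_adj ?_)
      exact huv
    · exact hle' (hΨnew u u.2 v v.2 huv hA')
  · exact (hΨA v hv).trans (hf₀ v hv)
  · exact hΨnew u u.2 v v.2 huv hnot

end Extension

/-! ### The second moment conditions -/

section Numerics

variable {V : Type*} [Fintype V] {H : SimpleGraph V} [DecidableRel H.Adj]
  {Δ : ℕ} {S : Finset V} {w : ℕ} {q L : ℝ}

/-- The second moment condition for two copies of the same minimal dense set. -/
lemma IsMinimalDense.le_pow_mul_pow_relEdges [DecidableEq V] {A : Set V}
    (h : IsMinimalDense H Δ S) (hΔ5 : 5 ≤ Δ) (hΔ : ∀ v, H.degree v ≤ Δ) (hSA : ∀ v ∈ S, v ∉ A)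
    (h1 : ∀ t m : ℕ, t ≤ 2 * Δ + 1 → 2 * m + 1 ≤ t * (Δ + 1) → L ≤ (w : ℝ) ^ t * q ^ m)
    (h2 : ∀ m : ℕ, 2 * m ≤ Δ * (Δ + 1) → L ≤ (w : ℝ) ^ Δ * q ^ m)
    {T : Finset V} (hT : T ⊆ S) (h0 : (relEdges H A T).card ≠ 0) :
    L ≤ (w : ℝ) ^ T.card * q ^ (relEdges H A T).card := by
  rcases h.card_relEdges hΔ5 hΔ hSA hT h0 with hm | ⟨ht, hm⟩
  · exact h1 _ _ ((Finset.card_le_card hT).trans (h.card_le hΔ)) hm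
  · rw [ht]; exact h2 _ hm

/-- The second moment condition for copies of two minimal dense sets: a factor `w` is gained. -/
lemma IsMinimalDense.le_pow_mul_pow_innerEdges (h : IsMinimalDense H Δ S) (hΔ5 : 5 ≤ Δ)
    (hΔ : ∀ v, H.degree v ≤ Δ)
    (h1 : ∀ t m : ℕ, t ≤ 2 * Δ + 1 → 2 * m + 1 ≤ t * (Δ + 1) → L ≤ (w : ℝ) ^ t * q ^ m)
    (h2 : ∀ m : ℕ, 2 * m ≤ Δ * (Δ + 1) → L ≤ (w : ℝ) ^ Δ * q ^ m)
    {T : Finset V} (hT : T ⊆ S) (h0 : (innerEdges H T).card ≠ 0) :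
    w * L ≤ (w : ℝ) ^ T.card * q ^ (innerEdges H T).card := by
  obtain ⟨ht2, hcases⟩ := h.card_innerEdges hΔ5 hΔ hT h0
  have hle : L ≤ (w : ℝ) ^ (T.card - 1) * q ^ (innerEdges H T).card := by
    rcases hcases with hm | ⟨ht, hm⟩
    · have := (Finset.card_le_card hT).trans (h.card_le hΔ)
      exact h1 _ _ (by omega) hm
    · rw [ht, Nat.add_sub_cancel]; exact h2 _ hm
  have e : (w : ℝ) ^ T.card = w * (w : ℝ) ^ (T.card - 1) := by
    rw [← pow_succ', Nat.sub_add_cancel (by omega)]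
  rw [e, mul_assoc]
  exact mul_le_mul_of_nonneg_left hle (Nat.cast_nonneg w)

end Numerics

end AlmostSpanning

open AlmostSpanning

theorem mainTheorem2 (ε : ℝ) (hε : 0 < ε) (Δ : ℕ) (hΔ : 5 ≤ Δ) (K : ℕ) (p : ℕ → ℝ)
    (hp : (fun n : ℕ => ((n : ℝ)⁻¹ * Real.log n ^ (1 / (Δ : ℝ))) ^ (2 / ((Δ : ℝ) + 1)))
      =o[atTop] p)
    (δ : ℝ) (hδ : 0 < δ) :
    ∀ᶠ n : ℕ in atTop,
      ∀ (m : ℕ) (H : SimpleGraph (Fin m)) [DecidableRel H.Adj],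
        (m : ℝ) ≤ (1 - ε) * n → (∀ v, H.degree v ≤ Δ) →
      ∀ (k : ℕ) (𝒮 : Fin k → Finset (Finset (Fin m))), k ≤ K →
        AlmostSpanning.IsGoodPartition H 𝒮 Δ n (ε / (3 * (2 * (Δ : ℝ) + 1) ^ 2)) →
      ∀ q : unitInterval, 0 < q → q < 1 → (1 - (q : ℝ)) ^ (k + 1) = 1 - p n →
      ∀ (h : Fin k) (g : Fin (k + 1) → SimpleGraph (Fin n))
        (f : SimpleGraph.Copy (AlmostSpanning.stage H 𝒮 (h : ℕ))
          (AlmostSpanning.unionUpTo g h.castSucc)),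
        1 - δ ≤ (ProbabilityTheory.cond (AlmostSpanning.roundsLaw n k q)
          {G | ∀ i ≤ h.castSucc, G i = g i}).real
            {G | AlmostSpanning.Extends H 𝒮 h f G} := by
  classical
  rcases lt_or_ge 1 ε with hε1 | hε1
  · -- there is no such graph `H`
    filter_upwards [eventually_ge_atTop 1] with n hn m H _ hm
    have hn0 : (1 : ℝ) ≤ n := by exact_mod_cast hn
    have hm0 : (0 : ℝ) ≤ m := Nat.cast_nonneg m
    nlinarith
  set D : ℝ := 2 * Δ + 1 with hD
  have hD1 : 1 ≤ D := by have : (0 : ℝ) ≤ Δ := Nat.cast_nonneg Δ; linarith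
  set c : ℝ := ε / (6 * D) with hc
  have hc0 : 0 < c := by positivity
  have hc1 : c ≤ 1 := (div_le_one (by positivity)).2 (by linarith)
  set C₁ : ℝ := 4 * (2 * D + 3) * 2 ^ (2 * Δ + 1) with hC₁
  have hC₁0 : 0 < C₁ := by positivity
  filter_upwards [eventually_le_pow_mul_pow (by omega : 1 ≤ Δ) K hp hc0 hc1
      (C := C₁ / c) (by positivity), eventually_ge_atTop 3, eventually_ge_atTop ⌈1 / c⌉₊,
    eventually_ge_atTop ⌈1 / δ⌉₊] with n hbound hn3 hnc hnδ m H _ hm hdeg k 𝒮 hk hgood q hq0 hq1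
      hqp h g f
  have hn3' : (3 : ℝ) ≤ n := by exact_mod_cast hn3
  have hn0 : (0 : ℝ) < n := by linarith
  have hlog : 0 < Real.log n := Real.log_pos (by linarith)
  have hnc' : 1 ≤ c * n := by
    have := Nat.ceil_le.1 hnc
    rwa [div_le_iff₀ hc0, mul_comm] at this
  have hnδ' : 1 / (n : ℝ) ≤ δ := by
    have := Nat.ceil_le.1 hnδ
    rw [div_le_iff₀ hδ] at this
    rw [div_le_iff₀ hn0]
    linarith
  set A := stageVerts 𝒮 (h : ℕ) with hA
  have hmd : ∀ S ∈ 𝒮 h, IsMinimalDense H Δ S := fun S hS => hgood.isMinimalDense hS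
  have hSA : ∀ S ∈ 𝒮 h, ∀ v ∈ S, v ∉ A := fun S hS v hv => hgood.notMem_stageVerts h hS hv
  -- the members of a batch have the same number of vertices
  obtain ⟨s, hs, hs0, hsD⟩ : ∃ s : ℕ, (∀ S ∈ 𝒮 h, S.card = s) ∧ 0 < s ∧ s ≤ 2 * Δ + 1 := by
    rcases (𝒮 h).eq_empty_or_nonempty with he | ⟨S₀, hS₀⟩
    · exact ⟨1, by simp [he], one_pos, by omega⟩
    · refine ⟨S₀.card, fun S hS => ?_, by have := (hmd S₀ hS₀).three_le; omega,
        (hmd S₀ hS₀).card_le hdeg⟩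
      obtain ⟨φ, -⟩ := hgood.isoIn h S hS S₀ hS₀
      simpa using Fintype.card_congr φ.toEquiv
  have hsD' : (s : ℝ) ≤ D := by rw [hD]; exact_mod_cast hsD
  let f₀ : Fin m → Fin n := fun v => if hv : v ∈ A then f ⟨v, hv⟩ else ⟨0, by omega⟩
  have hf₀ : ∀ v (hv : v ∈ A), f₀ v = f ⟨v, hv⟩ := fun v hv => dif_pos hv
  have hf₀inj : Set.InjOn f₀ A := fun u hu v hv huv => by
    rw [hf₀ u hu, hf₀ v hv] at huv
    exact congrArg Subtype.val (f.injective huv)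
  let F : Finset (Fin n) := Finset.univ \ (Finset.univ.filter fun v => v ∈ A).image f₀
  have hFA : ∀ v ∈ A, f₀ v ∉ F := fun v hv hvF =>
    (Finset.mem_sdiff.1 hvF).2 (Finset.mem_image_of_mem _ (by simpa using hv))
  set w : ℕ := ⌊2 * c * n⌋₊ with hw
  have hwc : c * n ≤ w := by
    have := Nat.lt_floor_add_one (2 * c * n)
    rw [← hw] at this
    linarith
  have hw0 : 0 < w := by
    have : (0 : ℝ) < w := by linarith
    exact_mod_cast this
  have hw2 : (w : ℝ) ≤ 2 * c * n := Nat.floor_le (by positivity)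
  have hcard := hgood.card_le h
  have hcardD : D * ((𝒮 h).card : ℝ) * (3 * D) ≤ ε * n := by
    have : D * (ε / (3 * D ^ 2) * n) * (3 * D) = ε * n := by field_simp
    rw [← this]
    gcongr
  have h𝒮n : (𝒮 h).card ≤ n := by
    have h0 : (0 : ℝ) ≤ (𝒮 h).card := Nat.cast_nonneg _
    have h1 : ((𝒮 h).card : ℝ) ≤ D * (𝒮 h).card * (3 * D) := by
      have h2 : 1 ≤ D * (3 * D) := by nlinarith
      nlinarith
    have h3 : ε * n ≤ n := by nlinarith
    exact_mod_cast h1.trans (hcardD.trans h3)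
  -- at least `ε n` vertices are unused, and `s w` of them remain when `2 s |𝒮 h|` are excluded
  have hF : s * w + 2 * s * (𝒮 h).card ≤ F.card := by
    have h1 : n ≤ F.card + m := by
      have h2 := Finset.le_card_sdiff ((Finset.univ.filter fun v => v ∈ A).image f₀)
        (Finset.univ : Finset (Fin n))
      have h3 : ((Finset.univ.filter fun v => v ∈ A).image f₀).card ≤ m :=
        Finset.card_image_le.trans ((Finset.card_le_univ _).trans (by simp))
      rw [Finset.card_univ, Fintype.card_fin] at h2
      have h4 : n - ((Finset.univ.filter fun v => v ∈ A).image f₀).card ≤ F.card := h2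
      omega
    have h1' : (n : ℝ) ≤ F.card + m := by exact_mod_cast h1
    have h2 : (s : ℝ) * w ≤ ε * n / 3 := by
      calc (s : ℝ) * w ≤ D * (2 * c * n) := by gcongr
        _ = ε * n / 3 := by rw [hc]; field_simp; ring
    have h3 : 2 * (s : ℝ) * (𝒮 h).card ≤ 2 * (ε * n / 3) := by
      have h5 : (s : ℝ) * (𝒮 h).card ≤ D * (𝒮 h).card := by gcongr
      have h6 : 0 ≤ D * ((𝒮 h).card : ℝ) := by positivity
      nlinarith
    have : (s : ℝ) * w + 2 * s * (𝒮 h).card ≤ F.card := by linarith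
    exact_mod_cast this
  obtain ⟨hb1, hb2⟩ := hbound k hk q hq0 hq1 hqp w hwc
  set κ : ℝ := 2 * (2 * s + 3) * Real.log n with hκ
  have hκ0 : 0 < κ := by positivity
  have hκC : 2 * κ * 2 ^ s ≤ C₁ * Real.log n := by
    have h1 : (2 : ℝ) ^ s ≤ 2 ^ (2 * Δ + 1) := pow_le_pow_right₀ (by norm_num) hsD
    calc 2 * κ * 2 ^ s = 4 * (2 * s + 3) * 2 ^ s * Real.log n := by rw [hκ]; ring
      _ ≤ 4 * (2 * D + 3) * 2 ^ (2 * Δ + 1) * Real.log n := by gcongr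
  have hC₁c : C₁ * Real.log n ≤ C₁ / c * Real.log n :=
    mul_le_mul_of_nonneg_right (le_div_self hC₁0.le hc0 hc1) hlog.le
  have hfail := binomialRandom_not_hallCondition_le (by omega : 1 ≤ n) H A f₀ hf₀inj q hq0 (𝒮 h) F
    hF h𝒮n hFA hw0 hs0 hs hSA
    (fun S hS S' hS' hne u hu v hv x hux => hgood.not_adj_of_adj hS hS' hne hu hv hux) hκ0 hκ
    (fun S hS => by
      have h1 := (hmd S hS).dense
      have h2 : innerEdges H S ⊆ relEdges H A S := by
        intro e he
        obtain ⟨heH, heS⟩ := mem_innerEdges.1 he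
        refine mem_relEdges.2 ⟨heH, ?_, fun v hv => Or.inl (heS v hv)⟩
        induction e using Sym2.inductionOn with
        | hf a b => exact ⟨a, by simp, heS a (by simp)⟩
      have := Finset.card_le_card h2
      omega)
    (fun S hS T hT h0 => (hκC.trans hC₁c).trans
      ((hmd S hS).le_pow_mul_pow_relEdges hΔ hdeg (hSA S hS) hb1 hb2 hT h0))
    (fun S hS T hT h0 => by
      refine le_trans ?_ ((hmd S hS).le_pow_mul_pow_innerEdges hΔ hdeg hb1 hb2 hT h0)
      calc 2 * κ * n * 2 ^ s = n * (2 * κ * 2 ^ s) := by ring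
        _ ≤ n * (C₁ * Real.log n) := by gcongr
        _ = (c * n) * (C₁ / c * Real.log n) := by field_simp
        _ ≤ w * (C₁ / c * Real.log n) := by gcongr)
  set μ := SimpleGraph.binomialRandom (Fin n) q
  have hgoodProb : 1 - δ ≤ μ.real {Γ | HallCondition H A f₀ F s (𝒮 h) Γ} := by
    have h1 := probReal_compl_eq_one_sub (μ := μ)
      (s := {Γ | HallCondition H A f₀ F s (𝒮 h) Γ}) (Set.toFinite _).measurableSet
    have h2 : {Γ | HallCondition H A f₀ F s (𝒮 h) Γ}ᶜ =
      {Γ | ¬ HallCondition H A f₀ F s (𝒮 h) Γ} := rfl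
    rw [h2] at h1
    linarith
  refine hgoodProb.trans ?_
  rw [← cond_roundsLaw_real hq0 hq1 h g]
  have hms : MeasurableSet {G : Fin (k + 1) → SimpleGraph (Fin n) | ∀ i ≤ h.castSucc, G i = g i} :=
    (Set.toFinite _).measurableSet
  rw [measureReal_def, measureReal_def,
    ← cond_inter_self hms {G | G h.succ ∈ {Γ | HallCondition H A f₀ F s (𝒮 h) Γ}},
    ← cond_inter_self hms {G | Extends H 𝒮 h f G}]
  refine ENNReal.toReal_mono (ne_top_of_le_ne_top ENNReal.one_ne_top ?_) (measure_mono ?_)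
  · exact prob_le_one
  · rintro G ⟨hG, hΓ⟩
    exact ⟨hG, extends_of_hallCondition hgood h g f f₀ hf₀ hs F hFA G hG hΓ⟩
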